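/- **Setting.** Let $n$ agents have rotations $R_1,\dots,R_n\in SO(3)$ with kinematics $\dot R_i=R_i\widehat{\omega}_i$, where $\widehat{p}$ is the skew-symmetric matrix with $\widehat{p}\,v=p\times v$. Equip $SO(3)$ with the Riemannian distance $d(R,S)=\arccos\big((\operatorname{trace}(R^TS)-1)/2\big)$ and $SO(3)^n$ with the product distance $\big(\sum_i d(R_i,S_i)^2\big)^{1/2}$. Let $B_r(I)$ and $\bar B_q(I)$ be the open and closed geodesic balls around the identity. A *local representation* is given by $0<r\le\pi$ and an odd, analytic, strictly increasing function $g:(-r,r)\to\mathbb R$ such that $f(R)=g(\theta)u$ is a diffeomorphism from $B_r(I)$ onto the open ball of radius $r'=\sup g\in(0,\infty]$ around $0$ in $\mathbb R^3$. Here $\theta=d(I,R)$ and $u=\frac{1}{2\sin\theta}(r_{32}-r_{23},\,r_{13}-r_{31},\,r_{21}-r_{12})^T$ is the rotation axis of $R=[r_{ij}]$, with $f(I)=0$. Put $y_{ij}=f(R_i^TR_j)$. Fix weights $a_{ij}>0$. At each time $t\in\mathbb R$ agent $i$ has a neighborhood $\mathcal N_i(t)\subset\{1,\dots,n\}$ with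 $i\in\mathcal N_i(t)$. Each $t\mapsto\mathcal N_i(t)$ is piecewise constant and right-continuous, with a lower bound $\tau_D>0$ on the time between consecutive switches. The pair $(i,j)$ is an edge at time $t$ if and only if $j\in\mathcal N_i(t)$. The controller is $$\omega_i=\sum_{j\in\mathcal N_i(t)}a_{ij}\,y_{ij}.$$ **Proposition.** Suppose that at every time $t$ and for each pair $(i,j)$, at least one of $(i,j)$ and $(j,i)$ is an edge, and suppose that there is $k>0$ with $g(\theta)\ge k\theta$ for all $\theta\in[0,r)$. Let $q<r/2$. Then the set $$\mathcal S=\{(R_1,\dots,R_n)\in(\bar B_q(I))^n: R_1=\dots=R_n\}$$ is globally exponentially stable relative to the strongly forward-invariant set $(\bar B_q(I))^n$ for the closed-loop dynamics, in the Riemannian metric. That is: 1. $(\bar B_q(I))^n$ is strongly forward-invariant: for every right-continuous, piecewise constant signal, with finitely many switches on every compact time interval, that switches between arbitrary digraphs with self-loops on $\{1,\dots,n\}$, and for every initial time $t_0$ and every initial state in $(\bar B_q(I))^n$, the closed-loop solution exists, is unique, is defined for all $t\ge t_0$, and stays in $(\bar B_q(I))^n$. 2. There are constants $c,\lambda>0$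 such that, for the given time-varying neighborhoods, every initial time $t_0$ and every closed-loop solution $R$ with $R(t_0)\in(\bar B_q(I))^n$, $$\operatorname{dist}(R(t),\mathcal S)\le c\,e^{-\lambda(t-t_0)}\operatorname{dist}(R(t_0),\mathcal S)\qquad\text{for all }t\ge t_0,$$ where $\operatorname{dist}$ is the product Riemannian distance to the set. -/

import Mathlib

open Set Filter Topology
open scoped Matrix ENNReal ContDiff

/-- The rotation group `SO(3)` of real `3 × 3` matrices. -/
abbrev SO3 : Type := Matrix.specialOrthogonalGroup (Fin 3) ℝ

/-- Euclidean three-space. -/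
abbrev E3 : Type := EuclideanSpace ℝ (Fin 3)

-- A norm on `3 × 3` matrices, needed to speak of derivatives of matrix-valued functions.
attribute [local instance] Matrix.frobeniusNormedAddCommGroup Matrix.frobeniusNormedSpace

/-- The hat map: `hat p` is the skew-symmetric matrix of the cross product with `p`. -/
def hat (p : E3) : Matrix (Fin 3) (Fin 3) ℝ :=
  !![0, -p 2, p 1;
     p 2, 0, -p 0;
     -p 1, p 0, 0]

/-- The rotation angle `θ = arccos ((trace M - 1) / 2)`. For a rotation `M` this is the
Riemannian distance from the identity, for the bi-invariant metric on `SO(3)` in which the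
tangent vector `R * hat ω` at `R` has length `‖ω‖`. -/
noncomputable def rotAngle (M : Matrix (Fin 3) (Fin 3) ℝ) : ℝ :=
  Real.arccos ((M.trace - 1) / 2)

/-- The rotation axis `u` of a rotation whose angle lies in `(0, π)`.
It is `0` by convention if the sine of the angle vanishes. -/
noncomputable def rotAxis (M : Matrix (Fin 3) (Fin 3) ℝ) : E3 :=
  (1 / (2 * Real.sin (rotAngle M))) •
    !₂[M 2 1 - M 1 2, M 0 2 - M 2 0, M 1 0 - M 0 1]

/-- The Riemannian distance on `SO(3)`: the angle of the relative rotation `Rᵀ S`. -/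
noncomputable def rotDist (R S : SO3) : ℝ :=
  rotAngle ((R : Matrix (Fin 3) (Fin 3) ℝ)ᵀ * (S : Matrix (Fin 3) (Fin 3) ℝ))

/-- The map `f(R) = g(θ) u`. -/
noncomputable def localRep (g : ℝ → ℝ) (M : Matrix (Fin 3) (Fin 3) ℝ) : E3 :=
  g (rotAngle M) • rotAxis M

/-- The open geodesic ball of radius `r` around the identity, as a set of matrices. -/
def openRotBall (r : ℝ) : Set (Matrix (Fin 3) (Fin 3) ℝ) :=
  {M | ∃ R : SO3, (R : Matrix (Fin 3) (Fin 3) ℝ) = M ∧ rotDist 1 R < r}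

/-- Smoothness of a map on an arbitrary subset of a normed space: near each point of the
subset the map is the restriction of a smooth map defined on an open set. -/
def SmoothOnSubset {E F : Type*} [NormedAddCommGroup E] [NormedSpace ℝ E]
    [NormedAddCommGroup F] [NormedSpace ℝ F] (f : E → F) (X : Set E) : Prop :=
  ∀ x ∈ X, ∃ U : Set E, IsOpen U ∧ x ∈ U ∧
    ∃ f' : E → F, ContDiffOn ℝ ∞ f' U ∧ EqOn f f' (X ∩ U)

/-- `f` restricts to a diffeomorphism from the subset `X` onto the subset `Y`. -/
def IsDiffeoBetween {E F : Type*} [NormedAddCommGroup E] [NormedSpace ℝ E]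
    [NormedAddCommGroup F] [NormedSpace ℝ F] (f : E → F) (X : Set E) (Y : Set F) : Prop :=
  SmoothOnSubset f X ∧
    ∃ h : F → E, SmoothOnSubset h Y ∧ MapsTo f X Y ∧ MapsTo h Y X ∧ InvOn h f X Y

/-- The function `g`, used on `(-r, r)`, gives a local representation `R ↦ g(θ) u` of rotations:
`g` is odd, analytic and strictly increasing, and `R ↦ g(θ) u` is a diffeomorphism from the open
geodesic ball of radius `r ≤ π` onto the open ball of radius `r' = sup g` (possibly `∞`). -/
structure IsLocalRepresentation (r : ℝ) (g : ℝ → ℝ) : Prop where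
  r_pos : 0 < r
  r_le_pi : r ≤ Real.pi
  odd : ∀ s ∈ Ioo (-r) r, g (-s) = -g s
  analytic : AnalyticOnNhd ℝ g (Ioo (-r) r)
  strictMono : StrictMonoOn g (Ioo (-r) r)
  diffeo : IsDiffeoBetween (localRep g) (openRotBall r)
    {v : E3 | ENNReal.ofReal ‖v‖ < ⨆ s ∈ Ioo 0 r, ENNReal.ofReal (g s)}

/-- The times at which a signal fails to be locally constant. -/
def switchTimes {α : Type*} (s : ℝ → α) : Set ℝ :=
  {t | ¬ ∀ᶠ u in 𝓝 t, s u = s t}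

/-- A piecewise constant, right-continuous signal with more than `τD` time between any two
switches. -/
structure HasDwellTime {α : Type*} (τD : ℝ) (s : ℝ → α) : Prop where
  right_cont : ∀ t, ∀ᶠ u in 𝓝[>] t, s u = s t
  dwell : ∀ t ∈ switchTimes s, ∀ t' ∈ switchTimes s, t < t' → τD < t' - t

/-- A piecewise constant, right-continuous signal with finitely many switches on every compact
time interval. -/
structure IsWellBehaved {α : Type*} (s : ℝ → α) : Prop where
  right_cont : ∀ t, ∀ᶠ u in 𝓝[>] t, s u = s t
  locally_finite : ∀ b c : ℝ, (switchTimes s ∩ Icc b c).Finite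

/-- The control law `ω_i = ∑_{j ∈ 𝒩_i} a_ij y_ij`, where `y_ij` is the local representation of the
relative rotation `R_iᵀ R_j`. -/
noncomputable def controlLaw {n : ℕ} (a : Fin n → Fin n → ℝ) (g : ℝ → ℝ)
    (N : Fin n → Finset (Fin n)) (R : Fin n → SO3) (i : Fin n) : E3 :=
  ∑ j ∈ N i, a i j •
    localRep g ((R i : Matrix (Fin 3) (Fin 3) ℝ)ᵀ * (R j : Matrix (Fin 3) (Fin 3) ℝ))

/-- `R` solves the closed loop kinematics `dR_i/dt = R_i * hat ω_i` on the time set `J`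
(an interval `[t₀, T)` or `[t₀, ∞)`) for the time-varying neighborhoods `N t i`. At a switching
time a solution has only one-sided derivatives. As the signal is right-continuous, a continuous
curve satisfies the equation between the switching times if and only if it satisfies the equation
at all times with the right derivative. -/
def IsSolutionOn {n : ℕ} (a : Fin n → Fin n → ℝ) (g : ℝ → ℝ)
    (N : ℝ → Fin n → Finset (Fin n)) (J : Set ℝ) (R : ℝ → Fin n → SO3) : Prop :=
  ContinuousOn R J ∧
    ∀ t ∈ J, ∀ i, HasDerivWithinAt (fun s => (R s i : Matrix (Fin 3) (Fin 3) ℝ))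
      ((R t i : Matrix (Fin 3) (Fin 3) ℝ) * hat (controlLaw a g (N t) (R t) i)) (Ici t) t

/-- Strong forward invariance of `D` for the closed loop system: for every well-behaved signal
switching between the digraphs with self-loops, every initial time and every initial state in
`D`, the solution exists, is unique, forward complete and stays in `D`. -/
def StronglyForwardInvariant {n : ℕ} (a : Fin n → Fin n → ℝ) (g : ℝ → ℝ)
    (D : Set (Fin n → SO3)) : Prop :=
  ∀ N : ℝ → Fin n → Finset (Fin n), IsWellBehaved N → (∀ t i, i ∈ N t i) →
    ∀ t₀ : ℝ, ∀ R₀ ∈ D, ∃ R : ℝ → Fin n → SO3,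
      IsSolutionOn a g N (Ici t₀) R ∧ R t₀ = R₀ ∧ (∀ t ≥ t₀, R t ∈ D) ∧
      ∀ (T : ℝ) (R' : ℝ → Fin n → SO3), IsSolutionOn a g N (Ico t₀ T) R' → R' t₀ = R₀ →
        ∀ t ∈ Ico t₀ T, R' t = R t

/-- The product Riemannian distance on `SO(3)^n`. -/
noncomputable def configDist {n : ℕ} (R S : Fin n → SO3) : ℝ :=
  Real.sqrt (∑ i, rotDist (R i) (S i) ^ 2)

/-- The Riemannian distance from a configuration to a set of configurations. -/
noncomputable def configDistToSet {n : ℕ} (R : Fin n → SO3) (D : Set (Fin n → SO3)) : ℝ :=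
  sInf (configDist R '' D)

/-- `D₁` is globally exponentially stable relative to `D₂` for the closed loop system with
time-varying neighborhoods `N`, in the Riemannian metric and uniformly in the initial time. -/
def GloballyExponentiallyStableRel {n : ℕ} (a : Fin n → Fin n → ℝ) (g : ℝ → ℝ)
    (N : ℝ → Fin n → Finset (Fin n)) (D₁ D₂ : Set (Fin n → SO3)) : Prop :=
  ∃ c > 0, ∃ lam > 0, ∀ (t₀ : ℝ) (R : ℝ → Fin n → SO3),
    IsSolutionOn a g N (Ici t₀) R → R t₀ ∈ D₂ → ∀ t ≥ t₀,
      configDistToSet (R t) D₁ ≤ c * Real.exp (-lam * (t - t₀)) * configDistToSet (R t₀) D₁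

/-- The set of configurations whose rotations lie in the closed geodesic ball of radius `q` around
the identity. -/
def closedRotBallPow (n : ℕ) (q : ℝ) : Set (Fin n → SO3) :=
  {R | ∀ i, rotDist 1 (R i) ≤ q}

/-- The synchronized configurations in the closed geodesic ball of radius `q`. -/
def synchronizedSet (n : ℕ) (q : ℝ) : Set (Fin n → SO3) :=
  {R | R ∈ closedRotBallPow n q ∧ ∀ i j, R i = R j}

/-!
The Lyapunov function is the largest squared chordal distance `max ‖R i - R j‖²`, together with
the same quantity measured against any rotation `Q` of the ball. In a geodesic triangle of
rotations close to the identity the angle at an endpoint of a longest side is acute, so for the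
agent farthest from `Q` every `f((R i)ᵀ R j)` has a nonnegative component along the geodesic from
`R i` to `Q`. With `Q = 1` this says that the distance of the farthest agent to the identity does
not increase, which is forward invariance. With `Q = R j` and `i, j` a farthest pair, one of the
edges `(i, j)`, `(j, i)` is present, and by `k θ ≤ g θ` it alone makes the squared distance decay
at an exponential rate. On a ball of radius less than `π / 2` the chordal and the Riemannian
distances are equivalent.
-/

open scoped Quaternion

/-- Real `3 × 3` matrices. -/
abbrev Mat3 : Type := Matrix (Fin 3) (Fin 3) ℝ

/-- The axial vector of the skew-symmetric matrix `A - Aᵀ`. For the rotation of angle `θ` around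
the unit vector `u` it equals `2 sin θ • u`. -/
def axialVec (A : Mat3) : E3 :=
  !₂[A 2 1 - A 1 2, A 0 2 - A 2 0, A 1 0 - A 0 1]

lemma inner_E3_eq (x y : E3) : inner ℝ x y = x 0 * y 0 + x 1 * y 1 + x 2 * y 2 := by
  simp only [PiLp.inner_apply, Real.inner_apply, Fin.sum_univ_three]

lemma norm_E3_sq (x : E3) : ‖x‖ ^ 2 = x 0 ^ 2 + x 1 ^ 2 + x 2 ^ 2 := by
  rw [EuclideanSpace.real_norm_sq_eq, Fin.sum_univ_three]

lemma dotProduct_E3_self (x : E3) : (x : Fin 3 → ℝ) ⬝ᵥ x = ‖x‖ ^ 2 := by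
  rw [norm_E3_sq, dotProduct, Fin.sum_univ_three]
  ring

section Hat

lemma hat_zero : hat 0 = 0 := by
  ext i j
  fin_cases i <;> fin_cases j <;> simp [hat]

lemma transpose_hat (p : E3) : (hat p)ᵀ = -hat p := by
  ext i j
  fin_cases i <;> fin_cases j <;> simp [hat]

lemma trace_hat (p : E3) : (hat p).trace = 0 := by
  simp [hat, Matrix.trace_fin_three]

lemma hat_mul_hat (p : E3) :
    hat p * hat p = Matrix.vecMulVec p p - ‖p‖ ^ 2 • (1 : Mat3) := by
  rw [norm_E3_sq]
  ext i j
  fin_cases i <;> fin_cases j <;>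
    simp [hat, Matrix.mul_apply, Matrix.vecMulVec_apply, Fin.sum_univ_three] <;> ring

lemma hat_axialVec (A : Mat3) : hat (axialVec A) = A - Aᵀ := by
  ext i j
  fin_cases i <;> fin_cases j <;> simp [hat, axialVec]

lemma axialVec_transpose (A : Mat3) : axialVec Aᵀ = -axialVec A := by
  ext i
  fin_cases i <;> simp [axialVec]

lemma trace_mul_hat (A : Mat3) (p : E3) : (A * hat p).trace = -inner ℝ (axialVec A) p := by
  simp only [inner_E3_eq, axialVec, hat, Matrix.trace_fin_three, Matrix.mul_apply,
    Fin.sum_univ_three, Matrix.of_apply, Matrix.cons_val', Matrix.cons_val_fin_one,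
    Matrix.cons_val_zero, Matrix.cons_val_one, Matrix.cons_val]
  ring

end Hat

lemma mem_specialOrthogonalGroup_iff_transpose_mul_self {m : Type*} [Fintype m] [DecidableEq m]
    {M : Matrix m m ℝ} :
    M ∈ Matrix.specialOrthogonalGroup m ℝ ↔ Mᵀ * M = 1 ∧ M.det = 1 := by
  rw [Matrix.mem_specialOrthogonalGroup_iff, Matrix.mem_orthogonalGroup_iff']

lemma adjugate_fin_three_eq_sq_sub {A : Type*} [CommRing A] (M : Matrix (Fin 3) (Fin 3) A) :
    M.adjugate = M * M - M.trace • M + M.adjugate.trace • (1 : Matrix (Fin 3) (Fin 3) A) := by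
  rw [Matrix.adjugate_fin_three]
  ext i j
  fin_cases i <;> fin_cases j <;>
    simp [Matrix.trace_fin_three, Matrix.mul_apply, Fin.sum_univ_three] <;> ring

namespace SO3

variable (R : SO3)

lemma coe_inv_mul (P Q : SO3) : ((P⁻¹ * Q : SO3) : Mat3) = (P : Mat3)ᵀ * Q := rfl

lemma transpose_mul_self : (R : Mat3)ᵀ * R = 1 :=
  (mem_specialOrthogonalGroup_iff_transpose_mul_self.1 R.2).1

lemma mul_transpose_self : (R : Mat3) * (R : Mat3)ᵀ = 1 := mul_eq_one_comm.1 R.transpose_mul_self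

lemma det_eq_one : (R : Mat3).det = 1 :=
  (mem_specialOrthogonalGroup_iff_transpose_mul_self.1 R.2).2

lemma adjugate_eq_transpose : (R : Mat3).adjugate = (R : Mat3)ᵀ :=
  calc (R : Mat3).adjugate = (R : Mat3)ᵀ * R * (R : Mat3).adjugate := by
        rw [R.transpose_mul_self, one_mul]
    _ = (R : Mat3)ᵀ := by rw [mul_assoc, Matrix.mul_adjugate, R.det_eq_one, one_smul, mul_one]

lemma mul_self_eq : (R : Mat3) * R =
    (R : Mat3).trace • (R : Mat3) - (R : Mat3).trace • (1 : Mat3) + (R : Mat3)ᵀ := by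
  have h := adjugate_fin_three_eq_sq_sub (R : Mat3)
  rw [adjugate_eq_transpose, Matrix.trace_transpose] at h
  rw [h]
  abel

lemma hat_axialVec_mul_self : hat (axialVec R) * hat (axialVec R) =
    (1 + (R : Mat3).trace) • ((R : Mat3) + (R : Mat3)ᵀ - (2 : ℝ) • (1 : Mat3)) := by
  have h := congrArg Matrix.transpose R.mul_self_eq
  simp only [Matrix.transpose_add, Matrix.transpose_sub, Matrix.transpose_smul,
    Matrix.transpose_mul, Matrix.transpose_one, Matrix.transpose_transpose] at h
  rw [hat_axialVec, sub_mul, mul_sub, mul_sub, R.mul_self_eq, h, R.transpose_mul_self,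
    R.mul_transpose_self]
  module

lemma norm_axialVec_sq :
    ‖axialVec R‖ ^ 2 = (1 + (R : Mat3).trace) * (3 - (R : Mat3).trace) := by
  have h := congrArg Matrix.trace (R.hat_axialVec_mul_self.symm.trans (hat_mul_hat _))
  simp only [Matrix.trace_smul, Matrix.trace_sub, Matrix.trace_add, Matrix.trace_transpose,
    Matrix.trace_one, Matrix.trace_vecMulVec, dotProduct_E3_self, Fintype.card_fin,
    smul_eq_mul] at h
  push_cast at h
  linarith

lemma vecMulVec_axialVec : Matrix.vecMulVec (axialVec R) (axialVec R) =
    (1 + (R : Mat3).trace) •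
      ((R : Mat3) + (R : Mat3)ᵀ + (1 - (R : Mat3).trace) • (1 : Mat3)) := by
  have h := (hat_mul_hat _).symm.trans R.hat_axialVec_mul_self
  rw [norm_axialVec_sq, sub_eq_iff_eq_add] at h
  rw [h]
  module

end SO3

/-- The imaginary part of a quaternion, as a vector. -/
def quatVec (p : ℍ[ℝ]) : E3 := !₂[p.imI, p.imJ, p.imK]

/-- The matrix of `v ↦ p v p*` on imaginary quaternions, written with Rodrigues' formula. It is a
rotation if `p` is a unit quaternion. -/
noncomputable def quatRot (p : ℍ[ℝ]) : Mat3 :=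
  (p.re ^ 2 - ‖quatVec p‖ ^ 2) • (1 : Mat3) +
    (2 : ℝ) • Matrix.vecMulVec (quatVec p) (quatVec p) + (2 * p.re) • hat (quatVec p)

section Quaternion

variable (p q s : ℍ[ℝ])

lemma quaternion_inner_eq : inner ℝ p q = p.re * q.re + inner ℝ (quatVec p) (quatVec q) := by
  simp only [Quaternion.inner_def, Quaternion.re_mul, Quaternion.re_star, Quaternion.imI_star,
    Quaternion.imJ_star, Quaternion.imK_star, quatVec, inner_E3_eq, Matrix.cons_val_zero,
    Matrix.cons_val_one, Matrix.cons_val]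
  ring

lemma quaternion_norm_sq_eq : ‖p‖ ^ 2 = p.re ^ 2 + ‖quatVec p‖ ^ 2 := by
  rw [← real_inner_self_eq_norm_sq, ← real_inner_self_eq_norm_sq, quaternion_inner_eq, sq]

lemma re_star_mul : (star p * q).re = inner ℝ p q := by
  simp [Quaternion.inner_def]

lemma inner_star_mul_star_mul :
    inner ℝ (star p * q) (star p * s) = ‖p‖ ^ 2 * inner ℝ q s := by
  simp only [quaternion_norm_sq_eq, quaternion_inner_eq, Quaternion.re_mul, Quaternion.imI_mul,
    Quaternion.imJ_mul, Quaternion.imK_mul, Quaternion.re_star, Quaternion.imI_star,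
    Quaternion.imJ_star, Quaternion.imK_star, inner_E3_eq, norm_E3_sq, quatVec,
    Matrix.cons_val_zero, Matrix.cons_val_one, Matrix.cons_val]
  ring

lemma inner_quatVec_star_mul : inner ℝ (quatVec (star p * q)) (quatVec (star p * s)) =
    ‖p‖ ^ 2 * inner ℝ q s - inner ℝ p q * inner ℝ p s := by
  have h := quaternion_inner_eq (star p * q) (star p * s)
  rw [inner_star_mul_star_mul, re_star_mul, re_star_mul] at h
  linarith

lemma transpose_quatRot_mul_quatRot : (quatRot p)ᵀ * quatRot q = quatRot (star p * q) := by
  simp only [quatRot, norm_E3_sq]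
  ext i j
  fin_cases i <;> fin_cases j <;>
    simp [quatVec, hat, Matrix.mul_apply, Matrix.one_apply, Fin.sum_univ_three] <;> ring

lemma quatRot_smul (c : ℝ) : quatRot (c • p) = c ^ 2 • quatRot p := by
  simp only [quatRot, norm_E3_sq]
  ext i j
  fin_cases i <;> fin_cases j <;>
    simp [quatVec, hat] <;> ring

lemma trace_quatRot : (quatRot p).trace = 4 * p.re ^ 2 - ‖p‖ ^ 2 := by
  simp only [quatRot, Matrix.trace_add, Matrix.trace_smul, Matrix.trace_one,
    Matrix.trace_vecMulVec, trace_hat, dotProduct_E3_self, quaternion_norm_sq_eq,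
    Fintype.card_fin, smul_eq_mul]
  push_cast
  ring

lemma axialVec_quatRot : axialVec (quatRot p) = (4 * p.re) • quatVec p := by
  ext i
  fin_cases i <;>
    simp [axialVec, quatRot, quatVec, hat] <;> ring

variable {p q}

lemma le_inner_of_le_two_mul_re_sq_sub_one {c : ℝ} (hp : ‖p‖ = 1) (hq : ‖q‖ = 1)
    (hp0 : 0 < p.re) (hq0 : 0 < q.re) (hcp : c ≤ 2 * p.re ^ 2 - 1) (hcq : c ≤ 2 * q.re ^ 2 - 1)
    (hc : 0 < c) : c ≤ inner ℝ p q := by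
  have hp' := quaternion_norm_sq_eq p
  have hq' := quaternion_norm_sq_eq q
  rw [hp] at hp'
  rw [hq] at hq'
  have h_vec : -((1 - c) / 2) ≤ inner ℝ (quatVec p) (quatVec q) := by
    have h := norm_add_sq_real (quatVec p) (quatVec q)
    nlinarith [sq_nonneg ‖quatVec p + quatVec q‖]
  have h_re : (1 + c) / 2 ≤ p.re * q.re := by
    refine (sq_le_sq₀ (by linarith) (by positivity)).1 ?_
    calc ((1 + c) / 2) ^ 2 = (1 + c) / 2 * ((1 + c) / 2) := sq _
      _ ≤ p.re ^ 2 * q.re ^ 2 := by gcongr <;> linarith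
      _ = (p.re * q.re) ^ 2 := (mul_pow _ _ 2).symm
  rw [quaternion_inner_eq]
  linarith

end Quaternion

namespace SO3

/-- Up to normalisation, the quaternion is `(1 + trace R, axialVec R)`. -/
lemma exists_quatRot_eq (R : SO3) (h : 0 < 1 + (R : Mat3).trace) :
    ∃ p : ℍ[ℝ], ‖p‖ = 1 ∧ 0 < p.re ∧ quatRot p = R := by
  set τ := (R : Mat3).trace with hτ
  set p : ℍ[ℝ] := ⟨1 + τ, axialVec R 0, axialVec R 1, axialVec R 2⟩
  have h_vec : quatVec p = axialVec R := by
    ext i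
    fin_cases i <;> rfl
  have h_norm : ‖p‖ ^ 2 = 4 * (1 + τ) := by
    rw [quaternion_norm_sq_eq, h_vec, norm_axialVec_sq, ← hτ]
    ring
  have h_pos : 0 < ‖p‖ := norm_pos_iff.2 fun hp => h.ne' (congrArg QuaternionAlgebra.re hp)
  have h_rot : quatRot p = (4 * (1 + τ)) • (R : Mat3) := by
    rw [quatRot, h_vec, norm_axialVec_sq, vecMulVec_axialVec, hat_axialVec, ← hτ]
    module
  refine ⟨‖p‖⁻¹ • p, norm_smul_inv_norm (norm_pos_iff.1 h_pos), mul_pos (inv_pos.2 h_pos) h, ?_⟩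
  rw [quatRot_smul, h_rot, ← h_norm, smul_smul, inv_pow, inv_mul_cancel₀ (by positivity), one_smul]

end SO3

section MatrixCalculus

attribute [local instance] Matrix.frobeniusNormedRing Matrix.frobeniusNormedAlgebra

lemma hasDerivWithinAt_transpose {m l : Type*} [Finite m] [Finite l] {F : ℝ → Matrix m l ℝ}
    {F' : Matrix m l ℝ} {s : Set ℝ} {t : ℝ} (hF : HasDerivWithinAt F F' s t) :
    HasDerivWithinAt (fun u => (F u)ᵀ) F'ᵀ s t := by
  have := Fintype.ofFinite m
  have := Fintype.ofFinite l
  exact hasDerivWithinAt_pi.2 fun i => hasDerivWithinAt_pi.2 fun j =>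
    hasDerivWithinAt_pi.1 (hasDerivWithinAt_pi.1 hF j) i

variable {m l : Type*} [Fintype m] [Fintype l]

lemma frobenius_norm_sq (M : Matrix m l ℝ) : ‖M‖ ^ 2 = (Mᵀ * M).trace := by
  rw [Matrix.frobenius_norm_def, ← Real.sqrt_eq_rpow, Real.sq_sqrt (by positivity),
    Finset.sum_comm]
  simp [Matrix.trace, Matrix.mul_apply, sq]

lemma trace_transpose_mul_comm (A B : Matrix m l ℝ) : (Aᵀ * B).trace = (Bᵀ * A).trace := by
  rw [← Matrix.trace_transpose, Matrix.transpose_mul, Matrix.transpose_transpose]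

lemma hasDerivWithinAt_trace {F : ℝ → Matrix m m ℝ} {F' : Matrix m m ℝ} {s : Set ℝ} {t : ℝ}
    (hF : HasDerivWithinAt F F' s t) : HasDerivWithinAt (fun u => (F u).trace) F'.trace s t :=
  (LinearMap.toContinuousLinearMap
    (Matrix.traceLinearMap m ℝ ℝ)).hasFDerivAt.comp_hasDerivWithinAt t hF

lemma hasDerivWithinAt_transpose_mul {F G : ℝ → Matrix m m ℝ} {F' G' : Matrix m m ℝ} {s : Set ℝ}
    {t : ℝ} (hF : HasDerivWithinAt F F' s t) (hG : HasDerivWithinAt G G' s t) :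
    HasDerivWithinAt (fun u => (F u)ᵀ * G u) (F'ᵀ * G t + (F t)ᵀ * G') s t := by
  classical
  exact (hasDerivWithinAt_transpose hF).fun_mul hG

variable [DecidableEq m] {X Ω : ℝ → Matrix m m ℝ} {b c t : ℝ}

/-- The defect `E = Xᵀ X - 1` satisfies `E' = E Ω - Ω E`, so its Frobenius norm is constant. -/
lemma transpose_mul_self_eq_one_of_skew_velocity (hX : ContinuousOn X (Icc b c))
    (hX' : ∀ t ∈ Ico b c, HasDerivWithinAt X (X t * Ω t) (Ici t) t)
    (hΩ : ∀ t ∈ Ico b c, (Ω t)ᵀ = -Ω t) (hb : (X b)ᵀ * X b = 1) (ht : t ∈ Icc b c) :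
    (X t)ᵀ * X t = 1 := by
  set E : ℝ → Matrix m m ℝ := fun t => (X t)ᵀ * X t - 1 with hE
  have hE_cont : ContinuousOn E (Icc b c) := by fun_prop
  have hE_deriv : ∀ t ∈ Ico b c, HasDerivWithinAt E (E t * Ω t - Ω t * E t) (Ici t) t := by
    intro t ht
    refine ((hasDerivWithinAt_transpose_mul (hX' t ht) (hX' t ht)).sub_const 1).congr_deriv ?_
    simp only [hE, Matrix.transpose_mul, hΩ t ht]
    noncomm_ring
  have h_const : ∀ t ∈ Icc b c, ((E t)ᵀ * E t).trace = ((E b)ᵀ * E b).trace := by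
    refine constant_of_has_deriv_right_zero (by fun_prop) fun t ht => ?_
    refine (hasDerivWithinAt_trace
      (hasDerivWithinAt_transpose_mul (hE_deriv t ht) (hE_deriv t ht))).congr_deriv ?_
    have hE_symm : (E t)ᵀ = E t := by simp [hE]
    rw [Matrix.trace_add, trace_transpose_mul_comm, hE_symm, mul_sub, Matrix.trace_sub,
      ← mul_assoc, ← mul_assoc, Matrix.trace_mul_cycle (E t) (Ω t), sub_self, add_zero]
  have hE_zero : ‖E t‖ ^ 2 = 0 := by
    rw [frobenius_norm_sq, h_const t ht]
    simp [hE, hb]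
  exact sub_eq_zero.1 (norm_eq_zero.1 (pow_eq_zero_iff two_ne_zero |>.1 hE_zero))

lemma det_eq_one_of_transpose_mul_self_eq_one (hX : ContinuousOn X (Icc b c))
    (h_orth : ∀ t ∈ Icc b c, (X t)ᵀ * X t = 1) (hb : (X b).det = 1) (ht : t ∈ Icc b c) :
    (X t).det = 1 := by
  have h_sq : ∀ u ∈ Icc b c, (X u).det ^ 2 = 1 := fun u hu => by
    simpa [sq] using congrArg Matrix.det (h_orth u hu)
  have hb_mem : b ∈ Icc b c := left_mem_Icc.2 (ht.1.trans ht.2)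
  rcases isPreconnected_Icc.eq_one_or_eq_neg_one_of_sq_eq (f := fun u => (X u).det) (by fun_prop)
    h_sq with h | h
  · exact h ht
  · have := h hb_mem
    norm_num [hb] at this

end MatrixCalculus

/-- Half the squared chordal (Frobenius) distance between two rotations. It equals
`2 - 2 cos θ` if `θ` is the Riemannian distance. -/
noncomputable def chordSq (P Q : SO3) : ℝ := ‖(P : Mat3) - Q‖ ^ 2 / 2

/-- The axial vector of the relative rotation `Pᵀ Q`: a multiple of the body-frame angular velocity
which turns `P` towards `Q` along a geodesic. -/
def relAxis (P Q : SO3) : E3 := axialVec ((P : Mat3)ᵀ * Q)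

section Chord

variable (P Q S : SO3)

lemma chordSq_nonneg : 0 ≤ chordSq P Q := by
  unfold chordSq
  positivity

lemma chordSq_comm : chordSq P Q = chordSq Q P := by
  rw [chordSq, chordSq, norm_sub_rev]

lemma chordSq_self : chordSq P P = 0 := by
  simp [chordSq]

lemma chordSq_le_two_mul_add : chordSq P Q ≤ 2 * chordSq P S + 2 * chordSq S Q := by
  have h := norm_sub_le_norm_sub_add_norm_sub (P : Mat3) S Q
  have h_sq := (pow_le_pow_left₀ (norm_nonneg _) h 2).trans add_sq_le
  unfold chordSq
  linarith

lemma chordSq_eq_three_sub_trace : chordSq P Q = 3 - ((P : Mat3)ᵀ * Q).trace := by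
  have h : ((P : Mat3) - (Q : Mat3))ᵀ * ((P : Mat3) - (Q : Mat3)) =
      (2 : ℝ) • (1 : Mat3) - (P : Mat3)ᵀ * Q - (Q : Mat3)ᵀ * P := by
    rw [Matrix.transpose_sub, sub_mul, mul_sub, mul_sub, P.transpose_mul_self,
      Q.transpose_mul_self]
    module
  rw [chordSq, frobenius_norm_sq, h, Matrix.trace_sub, Matrix.trace_sub,
    trace_transpose_mul_comm (Q : Mat3), Matrix.trace_smul, Matrix.trace_one, Fintype.card_fin,
    smul_eq_mul]
  push_cast
  ring

lemma chordSq_one_left : chordSq 1 Q = 3 - (Q : Mat3).trace := by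
  simp [chordSq_eq_three_sub_trace]

lemma relAxis_swap : relAxis Q P = -relAxis P Q := by
  rw [relAxis, relAxis, ← axialVec_transpose, Matrix.transpose_mul, Matrix.transpose_transpose]

lemma norm_relAxis_sq : ‖relAxis P Q‖ ^ 2 = chordSq P Q * (4 - chordSq P Q) := by
  rw [relAxis, ← SO3.coe_inv_mul, SO3.norm_axialVec_sq, SO3.coe_inv_mul,
    chordSq_eq_three_sub_trace]
  ring

lemma chordSq_le_four : chordSq P Q ≤ 4 := by
  have h := norm_relAxis_sq P Q
  nlinarith [sq_nonneg ‖relAxis P Q‖, chordSq_nonneg P Q]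

lemma hasDerivWithinAt_chordSq {F G : ℝ → SO3} {p p' : E3} {s : Set ℝ} {t : ℝ}
    (hF : HasDerivWithinAt (fun u => (F u : Mat3)) (F t * hat p) s t)
    (hG : HasDerivWithinAt (fun u => (G u : Mat3)) (G t * hat p') s t) :
    HasDerivWithinAt (fun u => chordSq (F u) (G u))
      (-(inner ℝ (relAxis (F t) (G t)) p + inner ℝ (relAxis (G t) (F t)) p')) s t := by
  simp only [chordSq_eq_three_sub_trace]
  refine ((hasDerivWithinAt_trace
    (hasDerivWithinAt_transpose_mul hF hG)).const_sub 3).congr_deriv ?_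
  rw [Matrix.trace_add, trace_transpose_mul_comm, ← mul_assoc, ← mul_assoc, trace_mul_hat,
    trace_mul_hat, ← relAxis, ← relAxis, relAxis_swap (F t)]
  simp only [inner_neg_left]
  ring

lemma hasDerivWithinAt_const_rotation (t : ℝ) (s : Set ℝ) :
    HasDerivWithinAt (fun _ => (P : Mat3)) ((P : Mat3) * hat 0) s t := by
  rw [hat_zero, mul_zero]
  exact hasDerivWithinAt_const t s _

variable {P Q S}

lemma chordSq_eq_of_quatRot_eq {p q : ℍ[ℝ]} (hp : ‖p‖ = 1) (hq : ‖q‖ = 1) (hP : quatRot p = P)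
    (hQ : quatRot q = Q) : chordSq P Q = 4 - 4 * inner ℝ p q ^ 2 := by
  rw [chordSq_eq_three_sub_trace, ← hP, ← hQ, transpose_quatRot_mul_quatRot, trace_quatRot,
    re_star_mul, norm_mul, norm_star, hp, hq]
  ring

lemma relAxis_eq_of_quatRot_eq {p q : ℍ[ℝ]} (hP : quatRot p = P) (hQ : quatRot q = Q) :
    relAxis P Q = (4 * inner ℝ p q) • quatVec (star p * q) := by
  rw [relAxis, ← hP, ← hQ, transpose_quatRot_mul_quatRot, axialVec_quatRot, re_star_mul]

lemma inner_relAxis_relAxis_of_quatRot_eq {p q s : ℍ[ℝ]} (hp : ‖p‖ = 1) (hP : quatRot p = P)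
    (hQ : quatRot q = Q) (hS : quatRot s = S) : inner ℝ (relAxis P Q) (relAxis P S) =
      16 * (inner ℝ p q * inner ℝ p s) * (inner ℝ q s - inner ℝ p q * inner ℝ p s) := by
  rw [relAxis_eq_of_quatRot_eq hP hQ, relAxis_eq_of_quatRot_eq hP hS, real_inner_smul_left,
    real_inner_smul_right, inner_quatVec_star_mul, hp]
  ring

lemma exists_quatRot_eq_of_chordSq_le {c : ℝ} (hc : 0 < c) (h : chordSq 1 P ≤ 2 - 2 * c) :
    ∃ p : ℍ[ℝ], ‖p‖ = 1 ∧ 0 < p.re ∧ quatRot p = P ∧ c ≤ 2 * p.re ^ 2 - 1 := by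
  rw [chordSq_one_left] at h
  obtain ⟨p, hp, hp0, hP'⟩ := P.exists_quatRot_eq (by linarith)
  refine ⟨p, hp, hp0, hP', ?_⟩
  rw [← hP', trace_quatRot, hp] at h
  linarith

lemma chordSq_le_of_chordSq_one_le {c : ℝ} (hc : 0 < c) (hP : chordSq 1 P ≤ 2 - 2 * c)
    (hQ : chordSq 1 Q ≤ 2 - 2 * c) : chordSq P Q ≤ 4 - 4 * c ^ 2 := by
  obtain ⟨p, hp, hp0, hP', hpc⟩ := exists_quatRot_eq_of_chordSq_le hc hP
  obtain ⟨q, hq, hq0, hQ', hqc⟩ := exists_quatRot_eq_of_chordSq_le hc hQ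
  rw [chordSq_eq_of_quatRot_eq hp hq hP' hQ']
  have h := le_inner_of_le_two_mul_re_sq_sub_one hp hq hp0 hq0 hpc hqc hc
  gcongr

/-- This is the law of cosines of the spherical triangle formed by the unit quaternions of `P`, `Q`
and `S`: the angle at `P` is not obtuse if `PQ` is at least as long as the opposite side `QS`. -/
lemma inner_relAxis_relAxis_nonneg (hP : chordSq 1 P < 2) (hQ : chordSq 1 Q < 2)
    (hS : chordSq 1 S < 2) (h : chordSq Q S ≤ chordSq P Q) :
    0 ≤ inner ℝ (relAxis P Q) (relAxis P S) := by
  obtain ⟨c, hc, hPc, hQc, hSc⟩ : ∃ c > 0, chordSq 1 P ≤ 2 - 2 * c ∧ chordSq 1 Q ≤ 2 - 2 * c ∧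
      chordSq 1 S ≤ 2 - 2 * c := by
    obtain ⟨C, hC, hC2⟩ := exists_between (max_lt hP (max_lt hQ hS))
    simp only [max_lt_iff] at hC
    exact ⟨1 - C / 2, by linarith, by linarith, by linarith, by linarith⟩
  obtain ⟨p, hp, hp0, hP', hpc⟩ := exists_quatRot_eq_of_chordSq_le hc hPc
  obtain ⟨q, hq, hq0, hQ', hqc⟩ := exists_quatRot_eq_of_chordSq_le hc hQc
  obtain ⟨s, hs, hs0, hS', hsc⟩ := exists_quatRot_eq_of_chordSq_le hc hSc
  have hpq := hc.trans_le (le_inner_of_le_two_mul_re_sq_sub_one hp hq hp0 hq0 hpc hqc hc)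
  have hps := hc.trans_le (le_inner_of_le_two_mul_re_sq_sub_one hp hs hp0 hs0 hpc hsc hc)
  have hqs := hc.trans_le (le_inner_of_le_two_mul_re_sq_sub_one hq hs hq0 hs0 hqc hsc hc)
  have h_le : inner ℝ p q ≤ inner ℝ q s := by
    rw [chordSq_eq_of_quatRot_eq hq hs hQ' hS', chordSq_eq_of_quatRot_eq hp hq hP' hQ'] at h
    exact (sq_le_sq₀ hpq.le hqs.le).1 (by linarith)
  have h_one : inner ℝ p s ≤ 1 := (real_inner_le_norm p s).trans (by simp [hp, hs])
  have h_mul : inner ℝ p q * inner ℝ p s ≤ inner ℝ q s :=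
    (mul_le_of_le_one_right hpq.le h_one).trans h_le
  rw [inner_relAxis_relAxis_of_quatRot_eq hp hP' hQ' hS']
  exact mul_nonneg (by positivity) (sub_nonneg.2 h_mul)

end Chord

section RotDist

variable (P Q : SO3) {q : ℝ}

lemma rotDist_nonneg : 0 ≤ rotDist P Q := Real.arccos_nonneg _

lemma rotDist_le_pi : rotDist P Q ≤ Real.pi := Real.arccos_le_pi _

lemma chordSq_eq_two_sub_two_mul_cos : chordSq P Q = 2 - 2 * Real.cos (rotDist P Q) := by
  have h := chordSq_eq_three_sub_trace P Q
  have h₀ := chordSq_nonneg P Q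
  have h₄ := chordSq_le_four P Q
  rw [rotDist, rotAngle, Real.cos_arccos (by linarith) (by linarith)]
  linarith

lemma chordSq_le_rotDist_sq : chordSq P Q ≤ rotDist P Q ^ 2 := by
  have h := Real.one_sub_sq_div_two_le_cos (x := rotDist P Q)
  rw [chordSq_eq_two_sub_two_mul_cos]
  linarith

lemma rotDist_sq_le : rotDist P Q ^ 2 ≤ Real.pi ^ 2 / 4 * chordSq P Q := by
  have h := Real.cos_le_one_sub_mul_cos_sq (x := rotDist P Q)
    ((abs_of_nonneg (rotDist_nonneg P Q)).trans_le (rotDist_le_pi P Q))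
  rw [chordSq_eq_two_sub_two_mul_cos]
  calc rotDist P Q ^ 2 = Real.pi ^ 2 / 4 * (2 * (2 / Real.pi ^ 2 * rotDist P Q ^ 2)) := by
        field_simp
        norm_num
    _ ≤ Real.pi ^ 2 / 4 * (2 - 2 * Real.cos (rotDist P Q)) := by
        gcongr
        linarith

variable {P Q}

lemma rotDist_le_iff (hq0 : 0 ≤ q) (hq : q ≤ Real.pi) :
    rotDist P Q ≤ q ↔ chordSq P Q ≤ 2 - 2 * Real.cos q := by
  rw [chordSq_eq_two_sub_two_mul_cos, ← Real.strictAntiOn_cos.le_iff_ge ⟨hq0, hq⟩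
    ⟨rotDist_nonneg P Q, rotDist_le_pi P Q⟩]
  constructor <;> intro h <;> linarith

lemma chordSq_le_of_rotDist_le (hq : q ≤ Real.pi) (h : rotDist P Q ≤ q) :
    chordSq P Q ≤ 2 - 2 * Real.cos q :=
  (rotDist_le_iff ((rotDist_nonneg P Q).trans h) hq).1 h

lemma cos_pos_of_rotDist_le (hq : q < Real.pi / 2) (h : rotDist P Q ≤ q) : 0 < Real.cos q :=
  Real.cos_pos_of_mem_Ioo ⟨by linarith [rotDist_nonneg P Q, Real.pi_pos], hq⟩

lemma chordSq_lt_two_of_rotDist_le (hq : q < Real.pi / 2) (h : rotDist P Q ≤ q) :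
    chordSq P Q < 2 := by
  linarith [chordSq_le_of_rotDist_le (by linarith [Real.pi_pos]) h, cos_pos_of_rotDist_le hq h]

lemma chordSq_le_of_rotDist_one_le (hq : q < Real.pi / 2) (hP : rotDist 1 P ≤ q)
    (hQ : rotDist 1 Q ≤ q) : chordSq P Q ≤ 4 - 4 * Real.cos q ^ 2 := by
  have hqπ : q ≤ Real.pi := by linarith [Real.pi_pos]
  exact chordSq_le_of_chordSq_one_le (cos_pos_of_rotDist_le hq hP)
    (chordSq_le_of_rotDist_le hqπ hP) (chordSq_le_of_rotDist_le hqπ hQ)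

lemma rotDist_le_two_mul_of_rotDist_one_le (hq : q < Real.pi / 2) (hP : rotDist 1 P ≤ q)
    (hQ : rotDist 1 Q ≤ q) : rotDist P Q ≤ 2 * q := by
  have hq0 : 0 ≤ q := (rotDist_nonneg 1 P).trans hP
  refine (rotDist_le_iff (by linarith) (by linarith)).2 ?_
  rw [Real.cos_two_mul]
  linarith [chordSq_le_of_rotDist_one_le hq hP hQ]

lemma mem_closedRotBallPow_iff {n : ℕ} (hq0 : 0 ≤ q) (hq : q ≤ Real.pi) {R : Fin n → SO3} :
    R ∈ closedRotBallPow n q ↔ ∀ i, chordSq 1 (R i) ≤ 2 - 2 * Real.cos q :=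
  forall_congr' fun _ => rotDist_le_iff hq0 hq

end RotDist

section ControlLaw

variable {n : ℕ} {r : ℝ} {g : ℝ → ℝ} {a : Fin n → Fin n → ℝ} {q k : ℝ}

lemma IsLocalRepresentation.nonneg (hg : IsLocalRepresentation r g) :
    ∀ θ ∈ Ico 0 r, 0 ≤ g θ := by
  intro θ hθ
  have hr := hg.r_pos
  have h0 := hg.odd 0 ⟨by linarith, hr⟩
  have h_mono := hg.strictMono.monotoneOn ⟨by linarith, hr⟩ ⟨by linarith [hθ.1], hθ.2⟩ hθ.1
  rw [neg_zero] at h0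
  linarith

lemma localRep_transpose_mul (g : ℝ → ℝ) (P Q : SO3) : localRep g ((P : Mat3)ᵀ * Q) =
    (g (rotDist P Q) / (2 * Real.sin (rotDist P Q))) • relAxis P Q := by
  rw [localRep, rotAxis, smul_smul, ← div_eq_mul_one_div]
  rfl

lemma inner_relAxis_localRep_nonneg (hg : ∀ θ ∈ Ico 0 r, 0 ≤ g θ) {P Q S : SO3}
    (hP : chordSq 1 P < 2) (hQ : chordSq 1 Q < 2) (hS : chordSq 1 S < 2)
    (h : chordSq Q S ≤ chordSq P Q) (hr : rotDist P S < r) :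
    0 ≤ inner ℝ (relAxis P Q) (localRep g ((P : Mat3)ᵀ * S)) := by
  rw [localRep_transpose_mul, real_inner_smul_right]
  have hg' := hg _ ⟨rotDist_nonneg P S, hr⟩
  have hsin := Real.sin_nonneg_of_nonneg_of_le_pi (rotDist_nonneg P S) (rotDist_le_pi P S)
  exact mul_nonneg (by positivity) (inner_relAxis_relAxis_nonneg hP hQ hS h)

lemma le_inner_relAxis_localRep (hk : 0 ≤ k) (hgk : ∀ θ ∈ Ico 0 r, k * θ ≤ g θ) {P Q : SO3}
    (hr : rotDist P Q < r) (hπ : rotDist P Q < Real.pi) :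
    k / 2 * (chordSq P Q * (4 - chordSq P Q)) ≤
      inner ℝ (relAxis P Q) (localRep g ((P : Mat3)ᵀ * Q)) := by
  rw [localRep_transpose_mul, real_inner_smul_right, real_inner_self_eq_norm_sq, norm_relAxis_sq]
  have h_nonneg : 0 ≤ chordSq P Q * (4 - chordSq P Q) :=
    mul_nonneg (chordSq_nonneg P Q) (sub_nonneg.2 (chordSq_le_four P Q))
  rcases (rotDist_nonneg P Q).eq_or_lt with h | h
  · simp [chordSq_eq_two_sub_two_mul_cos, ← h]
  · have hsin := Real.sin_pos_of_pos_of_lt_pi h hπ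
    refine mul_le_mul_of_nonneg_right ?_ h_nonneg
    rw [le_div_iff₀ (by positivity)]
    calc k / 2 * (2 * Real.sin (rotDist P Q)) = k * Real.sin (rotDist P Q) := by ring
      _ ≤ k * rotDist P Q := by gcongr; exact Real.sin_le h.le
      _ ≤ g (rotDist P Q) := hgk _ ⟨h.le, hr⟩

lemma inner_controlLaw (v : E3) (N : Fin n → Finset (Fin n)) (R : Fin n → SO3) (i : Fin n) :
    inner ℝ v (controlLaw a g N R i) =
      ∑ j ∈ N i, a i j * inner ℝ v (localRep g ((R i : Mat3)ᵀ * R j)) := by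
  simp only [controlLaw, inner_sum, real_inner_smul_right]

variable {N : Fin n → Finset (Fin n)} {R : Fin n → SO3} {i j : Fin n}

lemma inner_relAxis_localRep_nonneg_of_farthest (hg : ∀ θ ∈ Ico 0 r, 0 ≤ g θ)
    (hqπ : q < Real.pi / 2) (hqr : 2 * q < r) (hR : R ∈ closedRotBallPow n q) {Q : SO3}
    (hQ : chordSq 1 Q < 2) (h_far : ∀ j, chordSq Q (R j) ≤ chordSq Q (R i)) (j : Fin n) :
    0 ≤ inner ℝ (relAxis (R i) Q) (localRep g ((R i : Mat3)ᵀ * R j)) :=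
  inner_relAxis_localRep_nonneg hg (chordSq_lt_two_of_rotDist_le hqπ (hR i)) hQ
    (chordSq_lt_two_of_rotDist_le hqπ (hR j)) (chordSq_comm Q (R i) ▸ h_far j)
    ((rotDist_le_two_mul_of_rotDist_one_le hqπ (hR i) (hR j)).trans_lt hqr)

lemma inner_relAxis_controlLaw_nonneg (hg : ∀ θ ∈ Ico 0 r, 0 ≤ g θ) (ha : ∀ i j, 0 ≤ a i j)
    (hqπ : q < Real.pi / 2) (hqr : 2 * q < r) (hR : R ∈ closedRotBallPow n q) {Q : SO3}
    (hQ : chordSq 1 Q < 2) (h_far : ∀ j, chordSq Q (R j) ≤ chordSq Q (R i)) :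
    0 ≤ inner ℝ (relAxis (R i) Q) (controlLaw a g N R i) := by
  rw [inner_controlLaw]
  exact Finset.sum_nonneg fun j _ => mul_nonneg (ha i j)
    (inner_relAxis_localRep_nonneg_of_farthest hg hqπ hqr hR hQ h_far j)

lemma le_inner_relAxis_controlLaw (hk : 0 ≤ k) (hgk : ∀ θ ∈ Ico 0 r, k * θ ≤ g θ) {α : ℝ}
    (hα : 0 ≤ α) (ha : ∀ i j, α ≤ a i j) (hqπ : q < Real.pi / 2) (hqr : 2 * q < r)
    (hR : R ∈ closedRotBallPow n q) (hij : j ∈ N i)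
    (h_far : ∀ l, chordSq (R j) (R l) ≤ chordSq (R j) (R i)) :
    2 * α * k * Real.cos q ^ 2 * chordSq (R i) (R j) ≤
      inner ℝ (relAxis (R i) (R j)) (controlLaw a g N R i) := by
  have hg : ∀ θ ∈ Ico 0 r, 0 ≤ g θ := fun θ hθ => (mul_nonneg hk hθ.1).trans (hgk θ hθ)
  have h_rel := rotDist_le_two_mul_of_rotDist_one_le hqπ (hR i) (hR j)
  have h_self := le_inner_relAxis_localRep hk hgk (h_rel.trans_lt hqr) (by linarith)
  have h_chord := chordSq_le_of_rotDist_one_le hqπ (hR i) (hR j)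
  have h_chord0 := chordSq_nonneg (R i) (R j)
  rw [inner_controlLaw]
  calc 2 * α * k * Real.cos q ^ 2 * chordSq (R i) (R j)
      = α * (k / 2 * (chordSq (R i) (R j) * (4 * Real.cos q ^ 2))) := by ring
    _ ≤ α * (k / 2 * (chordSq (R i) (R j) * (4 - chordSq (R i) (R j)))) := by gcongr; linarith
    _ ≤ α * inner ℝ (relAxis (R i) (R j)) (localRep g ((R i : Mat3)ᵀ * R j)) := by gcongr
    _ ≤ a i j * inner ℝ (relAxis (R i) (R j)) (localRep g ((R i : Mat3)ᵀ * R j)) := by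
        refine mul_le_mul_of_nonneg_right (ha i j) ?_
        exact inner_relAxis_localRep_nonneg_of_farthest hg hqπ hqr hR
          (chordSq_lt_two_of_rotDist_le hqπ (hR j)) h_far j
    _ ≤ _ := Finset.single_le_sum (f := fun l => a i l *
          inner ℝ (relAxis (R i) (R j)) (localRep g ((R i : Mat3)ᵀ * R l)))
        (fun l _ => mul_nonneg (hα.trans (ha i l))
          (inner_relAxis_localRep_nonneg_of_farthest hg hqπ hqr hR
            (chordSq_lt_two_of_rotDist_le hqπ (hR j)) h_far l)) hij

end ControlLaw

section Comparison

variable {ι : Type*} [Finite ι] {V : ι → ℝ → ℝ} {b c : ℝ}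

lemma eventually_le_of_right_deriv_lt {f B : ℝ → ℝ} {d d' t : ℝ} (h_eq : f t = B t) (h_lt : d < d')
    (hf : HasDerivWithinAt f d (Ici t) t) (hB : HasDerivWithinAt B d' (Ici t) t) :
    ∀ᶠ u in 𝓝[>] t, f u ≤ B u := by
  have h_slope := (hasDerivWithinAt_iff_tendsto_slope' self_notMem_Ioi).1
    ((hf.sub hB).mono Ioi_subset_Ici_self)
  filter_upwards [h_slope.eventually (gt_mem_nhds (sub_neg.2 h_lt)), self_mem_nhdsWithin]
    with u hu htu
  rw [slope_def_field, div_lt_iff₀ (sub_pos.2 htu), zero_mul] at hu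
  simp only [Pi.sub_apply] at hu
  linarith

lemma forall_le_of_right_deriv_lt_barrier {B B' : ℝ → ℝ} (hV : ∀ i, ContinuousOn (V i) (Icc b c))
    (hB : ∀ t, HasDerivAt B (B' t) t) (hb : ∀ i, V i b ≤ B b)
    (h_contact : ∀ t ∈ Ico b c, ∀ i, V i t = B t → (∀ j, V j t ≤ B t) →
      ∃ d < B' t, HasDerivWithinAt (V i) d (Ici t) t) :
    ∀ t ∈ Icc b c, ∀ i, V i t ≤ B t := by
  have hB_cont : Continuous B := continuous_iff_continuousAt.2 fun t => (hB t).continuousAt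
  suffices h : Icc b c ⊆ {t | ∀ i, V i t ≤ B t} from fun t ht => h ht
  refine IsClosed.Icc_subset_of_forall_exists_gt ?_ hb ?_
  · have h_inter : {t | ∀ i, V i t ≤ B t} ∩ Icc b c =
        Icc b c ∩ ⋂ i, {t ∈ Icc b c | V i t ≤ B t} := by
      ext t
      simp only [mem_inter_iff, mem_ofPred_eq, mem_iInter]
      exact ⟨fun h => ⟨h.2, fun i => ⟨h.2, h.1 i⟩⟩, fun h => ⟨fun i => (h.2 i).2, h.1⟩⟩
    rw [h_inter]
    exact isClosed_Icc.inter (isClosed_iInter fun i =>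
      isClosed_Icc.isClosed_le (hV i) hB_cont.continuousOn)
  · rintro t ⟨ht, htI⟩ y hy
    have h_ev : ∀ i, ∀ᶠ u in 𝓝[>] t, V i u ≤ B u := by
      intro i
      rcases (ht i).lt_or_eq with h_lt | h_eq
      · have hVt : ContinuousWithinAt (V i) (Ioi t) t :=
          (hV i t ⟨htI.1, htI.2.le⟩).mono_of_mem_nhdsWithin
            (mem_of_superset (Ioc_mem_nhdsGT htI.2) fun u hu => ⟨htI.1.trans hu.1.le, hu.2⟩)
        exact (hVt.eventually_lt hB_cont.continuousWithinAt h_lt).mono fun u hu => hu.le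
      · obtain ⟨d, hd, h_deriv⟩ := h_contact t htI i h_eq ht
        exact eventually_le_of_right_deriv_lt h_eq hd h_deriv (hB t).hasDerivWithinAt
    obtain ⟨u, hu, huy⟩ := ((eventually_all.2 h_ev).and (Ioc_mem_nhdsGT hy)).exists
    exact ⟨u, hu, huy⟩

/-- The differential inequality is only needed for the largest member of the family. The barrier
`(C + ε * (1 + (t - b))) * exp (-lam * (t - b))` grows strictly faster than a maximal `V i` may at a
first contact, and `ε` then tends to `0`. -/
lemma forall_le_mul_exp_of_right_deriv_le {C C' lam : ℝ} (hlam : 0 ≤ lam) (hC : 0 ≤ C)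
    (hCC' : C < C') (hV : ∀ i, ContinuousOn (V i) (Icc b c)) (hb : ∀ i, V i b ≤ C)
    (h_max : ∀ t ∈ Ico b c, ∀ i, V i t < C' → (∀ j, V j t ≤ V i t) →
      ∃ d ≤ -lam * V i t, HasDerivWithinAt (V i) d (Ici t) t) :
    ∀ t ∈ Icc b c, ∀ i, V i t ≤ C * Real.exp (-lam * (t - b)) := by
  intro t ht i
  let barrier (ε s : ℝ) : ℝ := (C + ε * (1 + (s - b))) * Real.exp (-lam * (s - b))
  have h_lim (s : ℝ) : Tendsto (fun ε => C + ε * (1 + (s - b))) (𝓝[>] 0) (𝓝 C) := by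
    have h_cont : Continuous fun ε => C + ε * (1 + (s - b)) := by fun_prop
    simpa using (h_cont.tendsto 0).mono_left nhdsWithin_le_nhds
  refine ge_of_tendsto ((h_lim t).mul_const (Real.exp (-lam * (t - b)))) ?_
  filter_upwards [(h_lim c).eventually (gt_mem_nhds hCC'), self_mem_nhdsWithin] with ε hεc hε
  have hε0 : 0 < ε := hε
  have h_barrier_deriv : ∀ s, HasDerivAt (barrier ε)
      (ε * Real.exp (-lam * (s - b)) - lam * barrier ε s) s := by
    intro s
    have h_sub : HasDerivAt (fun u => u - b) 1 s := (hasDerivAt_id s).sub_const b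
    refine ((((h_sub.const_add 1).const_mul ε).const_add C).mul
      (h_sub.const_mul (-lam)).exp).congr_deriv ?_
    simp only [barrier]
    ring
  refine forall_le_of_right_deriv_lt_barrier hV h_barrier_deriv (fun j => ?_)
    (fun s hs j h_eq h_le => ?_) t ht i
  · simpa [barrier] using (hb j).trans (le_add_of_nonneg_right hε0.le)
  · have h_lt : barrier ε s < C' := by
      have h_exp : Real.exp (-lam * (s - b)) ≤ 1 :=
        Real.exp_le_one_iff.2 (by nlinarith [hs.1])
      have h_pos : 0 ≤ C + ε * (1 + (s - b)) := by
        have := sub_nonneg.2 hs.1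
        positivity
      calc barrier ε s ≤ C + ε * (1 + (s - b)) := mul_le_of_le_one_right h_pos h_exp
        _ ≤ C + ε * (1 + (c - b)) := by gcongr; exact hs.2.le
        _ < C' := hεc
    obtain ⟨d, hd, h_deriv⟩ := h_max s hs j (h_eq.trans_lt h_lt) fun l => (h_le l).trans h_eq.ge
    refine ⟨d, ?_, h_deriv⟩
    rw [h_eq] at hd
    linarith [mul_pos hε0 (Real.exp_pos (-lam * (s - b)))]

end Comparison

/-- `R` solves the closed loop on the compact interval `[b, c]` and stays in `D` there. Unlike
`IsSolutionOn`, this asks for no derivative at the right endpoint, so that solutions on adjacent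
intervals can be glued. -/
structure IsSolutionWithin {n : ℕ} (a : Fin n → Fin n → ℝ) (g : ℝ → ℝ)
    (N : ℝ → Fin n → Finset (Fin n)) (D : Set (Fin n → SO3)) (b c : ℝ)
    (R : ℝ → Fin n → SO3) : Prop where
  continuousOn : ContinuousOn R (Icc b c)
  hasDerivWithinAt : ∀ t ∈ Ico b c, ∀ i, HasDerivWithinAt (fun s => (R s i : Mat3))
    (R t i * hat (controlLaw a g (N t) (R t) i)) (Ici t) t
  mem : ∀ t ∈ Icc b c, R t ∈ D

section Lyapunov

variable {n : ℕ} {r q k b c : ℝ} {g : ℝ → ℝ} {a : Fin n → Fin n → ℝ}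
  {N : ℝ → Fin n → Finset (Fin n)} {R : ℝ → Fin n → SO3}

lemma continuousOn_chordSq {F G : ℝ → SO3} {s : Set ℝ} (hF : ContinuousOn F s)
    (hG : ContinuousOn G s) : ContinuousOn (fun t => chordSq (F t) (G t)) s := by
  have hF' := continuous_subtype_val.comp_continuousOn hF
  have hG' := continuous_subtype_val.comp_continuousOn hG
  exact ((hF'.sub hG').norm.pow 2).div_const 2

lemma mem_closedRotBallPow_of_hasDerivWithinAt (hg : ∀ θ ∈ Ico 0 r, 0 ≤ g θ)
    (ha : ∀ i j, 0 ≤ a i j) {q' : ℝ} (hqq' : q < q') (hq'π : q' < Real.pi / 2) (hq'r : 2 * q' < r)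
    (hR : ContinuousOn R (Icc b c)) (hb : R b ∈ closedRotBallPow n q)
    (hR' : ∀ t ∈ Ico b c, R t ∈ closedRotBallPow n q' → ∀ i,
      HasDerivWithinAt (fun s => (R s i : Mat3))
        (R t i * hat (controlLaw a g (N t) (R t) i)) (Ici t) t) {t : ℝ} (ht : t ∈ Icc b c) :
    R t ∈ closedRotBallPow n q := by
  intro i
  have hq0 : 0 ≤ q := (rotDist_nonneg 1 (R b i)).trans (hb i)
  have hq' : q' ≤ Real.pi := by linarith [Real.pi_pos]
  have hcos : Real.cos q' < Real.cos q := Real.cos_lt_cos_of_nonneg_of_le_pi hq0 hq' hqq'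
  rw [rotDist_le_iff hq0 (hqq'.le.trans hq')]
  suffices h : chordSq 1 (R t i) ≤ (2 - 2 * Real.cos q) * Real.exp (-0 * (t - b)) by simpa using h
  refine forall_le_mul_exp_of_right_deriv_le (V := fun i t => chordSq 1 (R t i))
    (C' := 2 - 2 * Real.cos q') le_rfl (by linarith [Real.cos_le_one q]) (by linarith)
    (fun j => ?_) ((mem_closedRotBallPow_iff hq0 (hqq'.le.trans hq')).1 hb)
    (fun s hs j h_lt h_max => ?_) t ht i
  · exact continuousOn_chordSq continuousOn_const (continuousOn_pi.1 hR j)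
  · have hRs : R s ∈ closedRotBallPow n q' :=
      (mem_closedRotBallPow_iff (hq0.trans hqq'.le) hq').2 fun l => (h_max l).trans h_lt.le
    refine ⟨_, ?_, hasDerivWithinAt_chordSq (hasDerivWithinAt_const_rotation 1 s (Ici s))
      (hR' s hs hRs j)⟩
    have h_toward := inner_relAxis_controlLaw_nonneg (N := N s) hg ha hq'π hq'r hRs
      ((chordSq_self 1).trans_lt two_pos) h_max
    simpa using h_toward

lemma chordSq_le_mul_exp_of_isSolutionWithin (hk : 0 ≤ k) (hgk : ∀ θ ∈ Ico 0 r, k * θ ≤ g θ)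
    {α : ℝ} (hα : 0 ≤ α) (ha : ∀ i j, α ≤ a i j) (hqπ : q < Real.pi / 2) (hqr : 2 * q < r)
    (h_edge : ∀ t i j, j ∈ N t i ∨ i ∈ N t j)
    (hR : IsSolutionWithin a g N (closedRotBallPow n q) b c R) {C : ℝ}
    (hb : ∀ i j, chordSq (R b i) (R b j) ≤ C) {t : ℝ} (ht : t ∈ Icc b c) (i j : Fin n) :
    chordSq (R t i) (R t j) ≤ C * Real.exp (-(2 * α * k * Real.cos q ^ 2) * (t - b)) := by
  have hg : ∀ θ ∈ Ico 0 r, 0 ≤ g θ := fun θ hθ => (mul_nonneg hk hθ.1).trans (hgk θ hθ)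
  refine forall_le_mul_exp_of_right_deriv_le
    (V := fun (p : Fin n × Fin n) t => chordSq (R t p.1) (R t p.2)) (by positivity)
    ((chordSq_nonneg _ _).trans (hb i j)) (lt_add_one C) (fun p => ?_) (fun p => hb p.1 p.2)
    ?_ t ht (i, j)
  · exact continuousOn_chordSq (continuousOn_pi.1 hR.continuousOn p.1)
      (continuousOn_pi.1 hR.continuousOn p.2)
  · rintro s hs ⟨i, j⟩ - h_max
    refine ⟨_, ?_, hasDerivWithinAt_chordSq (hR.hasDerivWithinAt s hs i)
      (hR.hasDerivWithinAt s hs j)⟩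
    have hRs := hR.mem s (Ico_subset_Icc_self hs)
    have h_lt := fun l => chordSq_lt_two_of_rotDist_le hqπ (hRs l)
    have h_far_i : ∀ l, chordSq (R s j) (R s l) ≤ chordSq (R s j) (R s i) := fun l =>
      chordSq_comm (R s i) (R s j) ▸ h_max (j, l)
    have h_far_j : ∀ l, chordSq (R s i) (R s l) ≤ chordSq (R s i) (R s j) := fun l => h_max (i, l)
    have h_nonneg := fun l m => hα.trans (ha l m)
    have h_toward_j := inner_relAxis_controlLaw_nonneg (N := N s) hg h_nonneg hqπ hqr hRs (h_lt j)
      h_far_i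
    have h_toward_i := inner_relAxis_controlLaw_nonneg (N := N s) hg h_nonneg hqπ hqr hRs (h_lt i)
      h_far_j
    rcases h_edge s i j with hij | hji
    · have h_decay := le_inner_relAxis_controlLaw hk hgk hα ha hqπ hqr hRs hij h_far_i
      linarith
    · have h_decay := le_inner_relAxis_controlLaw hk hgk hα ha hqπ hqr hRs hji h_far_j
      rw [chordSq_comm] at h_decay
      linarith

end Lyapunov

section LocallyLipschitz

lemma locallyLipschitz_pi {ι α : Type*} {β : ι → Type*} [Fintype ι] [PseudoEMetricSpace α]
    [∀ i, PseudoEMetricSpace (β i)] {f : α → ∀ i, β i}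
    (hf : ∀ i, LocallyLipschitz fun x => f x i) : LocallyLipschitz f := by
  intro x
  choose K u hu hK using fun i => hf i x
  refine ⟨Finset.univ.sup K, ⋂ i, u i, Filter.iInter_mem.2 hu, fun y hy z hz => ?_⟩
  rw [edist_pi_le_iff]
  intro i
  refine (hK i (mem_iInter.1 hy i) (mem_iInter.1 hz i)).trans ?_
  gcongr
  exact Finset.le_sup (Finset.mem_univ i)

lemma locallyLipschitz_sum {ι α E : Type*} [PseudoEMetricSpace α] [SeminormedAddCommGroup E]
    {f : ι → α → E} (s : Finset ι) (hf : ∀ i ∈ s, LocallyLipschitz (f i)) :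
    LocallyLipschitz fun x => ∑ i ∈ s, f i x := by
  simp_rw [← Finset.sum_apply]
  exact Finset.sum_induction _ LocallyLipschitz (fun _ _ => LocallyLipschitz.add)
    (LocallyLipschitz.const 0) hf

lemma SmoothOnSubset.locallyLipschitzOn {E F : Type*} [NormedAddCommGroup E] [NormedSpace ℝ E]
    [NormedAddCommGroup F] [NormedSpace ℝ F] {f : E → F} {X : Set E} (hf : SmoothOnSubset f X) :
    LocallyLipschitzOn X f := by
  intro x hx
  obtain ⟨U, hU, hxU, f', hf', h_eq⟩ := hf x hx
  obtain ⟨K, t, ht, hK⟩ :=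
    (((hf' x hxU).contDiffAt (hU.mem_nhds hxU)).of_le (by simp)).exists_lipschitzOnWith
  refine ⟨K, X ∩ (U ∩ t), Filter.inter_mem self_mem_nhdsWithin
    (mem_nhdsWithin_of_mem_nhds (Filter.inter_mem (hU.mem_nhds hxU) ht)), fun y hy z hz => ?_⟩
  rw [h_eq ⟨hy.1, hy.2.1⟩, h_eq ⟨hz.1, hz.2.1⟩]
  exact hK hy.2.2 hz.2.2

variable {ι E : Type*} [Finite ι]

lemma exists_common_lipschitzOnWith {F : Type*} [PseudoMetricSpace E] [PseudoMetricSpace F]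
    {v : ι → E → F} (hv : ∀ i, LocallyLipschitz (v i)) {s : Set E} (hs : IsCompact s) :
    ∃ K, ∀ i, LipschitzOnWith K (v i) s := by
  have := Fintype.ofFinite ι
  choose K hK using fun i =>
    ((hv i).locallyLipschitzOn (s := s)).exists_lipschitzOnWith_of_compact hs
  exact ⟨Finset.univ.sup K, fun i => (hK i).weaken (Finset.le_sup (Finset.mem_univ i))⟩

variable [NormedAddCommGroup E] [NormedSpace ℝ E]

lemma exists_hasDerivWithinAt_Ici_of_lipschitzOnWith [CompleteSpace E] {v : E → E} {x : E}
    {L K : NNReal} (hL : ∀ y ∈ Metric.closedBall x 1, ‖v y‖ ≤ L)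
    (hK : LipschitzOnWith K v (Metric.closedBall x 1)) (t₀ : ℝ) :
    ∃ γ : ℝ → E, γ t₀ = x ∧ ContinuousOn γ (Icc t₀ (t₀ + 1 / (L + 1))) ∧
      ∀ t ∈ Ico t₀ (t₀ + 1 / (L + 1)), HasDerivWithinAt γ (v (γ t)) (Ici t) t := by
  have hε : 0 < 1 / ((L : ℝ) + 1) := by positivity
  have h_picard : IsPicardLindelof (fun _ => v) (tmin := t₀) (tmax := t₀ + 1 / (L + 1))
      ⟨t₀, left_mem_Icc.2 (by linarith)⟩ x 1 0 L K := by
    refine IsPicardLindelof.of_time_independent hL hK ?_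
    simp only [add_sub_cancel_left, sub_self, NNReal.coe_one, NNReal.coe_zero, sub_zero]
    rw [max_eq_left hε.le, mul_one_div, div_le_one (by positivity)]
    linarith
  obtain ⟨γ, h₀, hγ⟩ := h_picard.exists_eq_forall_mem_Icc_hasDerivWithinAt₀
  refine ⟨γ, h₀, fun t ht => (hγ t ht).continuousWithinAt, fun t ht => ?_⟩
  exact (hγ t (Ico_subset_Icc_self ht)).mono_of_mem_nhdsWithin
    (mem_of_superset (Icc_mem_nhdsGE ht.2) (Icc_subset_Icc_left ht.1))

lemma exists_uniform_hasDerivWithinAt_Ici [FiniteDimensional ℝ E] {v : ι → E → E}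
    (hv : ∀ i, LocallyLipschitz (v i)) {s : Set E} (hs : Bornology.IsBounded s) :
    ∃ ε > 0, ∀ i, ∀ x ∈ s, ∀ t₀ : ℝ, ∃ γ : ℝ → E, γ t₀ = x ∧
      ContinuousOn γ (Icc t₀ (t₀ + ε)) ∧
      ∀ t ∈ Ico t₀ (t₀ + ε), HasDerivWithinAt γ (v i (γ t)) (Ici t) t := by
  have := Fintype.ofFinite ι
  have : ProperSpace E := FiniteDimensional.proper ℝ E
  have : CompleteSpace E := FiniteDimensional.complete ℝ E
  have h_compact : IsCompact (Metric.cthickening 1 s) :=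
    Metric.isCompact_of_isClosed_isBounded Metric.isClosed_cthickening hs.cthickening
  obtain ⟨K, hK⟩ := exists_common_lipschitzOnWith hv h_compact
  obtain ⟨C, hC⟩ := h_compact.exists_bound_of_continuousOn
    (continuous_pi fun i => (hv i).continuous).continuousOn
  have hL : ∀ i, ∀ y ∈ Metric.cthickening 1 s, ‖v i y‖ ≤ C.toNNReal := fun i y hy =>
    ((norm_le_pi_norm (fun j => v j y) i).trans (hC y hy)).trans (Real.le_coe_toNNReal C)
  refine ⟨1 / (C.toNNReal + 1), by positivity, fun i x hx t₀ => ?_⟩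
  have h_sub := Metric.closedBall_subset_cthickening hx 1
  exact exists_hasDerivWithinAt_Ici_of_lipschitzOnWith (fun y hy => hL i y (h_sub hy))
    ((hK i).mono h_sub) t₀

end LocallyLipschitz

/-- The closed loop vector field on `n`-tuples of matrices, with the local representation replaced
by an arbitrary map `φ`. -/
noncomputable def closedLoopField {n : ℕ} (a : Fin n → Fin n → ℝ) (φ : Mat3 → E3)
    (N : Fin n → Finset (Fin n)) (X : Fin n → Mat3) (i : Fin n) : Mat3 :=
  X i * hat (∑ j ∈ N i, a i j • φ ((X i)ᵀ * X j))

lemma isLinearMap_hat : IsLinearMap ℝ hat where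
  map_add v w := by
    ext i j
    fin_cases i <;> fin_cases j <;> simp [hat] <;> ring
  map_smul c v := by
    ext i j
    fin_cases i <;> fin_cases j <;> simp [hat]

section MatrixProducts

attribute [local instance] Matrix.frobeniusNormedRing Matrix.frobeniusNormedAlgebra

lemma locallyLipschitz_mul_hat : LocallyLipschitz fun p : Mat3 × E3 => p.1 * hat p.2 :=
  (contDiff_fst.mul ((LinearMap.toContinuousLinearMap (isLinearMap_hat.mk' hat)).contDiff.comp
    contDiff_snd)).locallyLipschitz

lemma locallyLipschitz_transpose_mul : LocallyLipschitz fun p : Mat3 × Mat3 => p.1ᵀ * p.2 :=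
  (((LinearMap.toContinuousLinearMap (Matrix.transposeLinearEquiv (Fin 3) (Fin 3) ℝ
    ℝ).toLinearMap).contDiff.comp contDiff_fst).mul contDiff_snd).locallyLipschitz

end MatrixProducts

lemma locallyLipschitz_closedLoopField {n : ℕ} (a : Fin n → Fin n → ℝ) {φ : Mat3 → E3}
    (hφ : LocallyLipschitz φ) (N : Fin n → Finset (Fin n)) :
    LocallyLipschitz (closedLoopField a φ N) := by
  have h_eval (i : Fin n) : LocallyLipschitz fun X : Fin n → Mat3 => X i :=
    (LipschitzWith.eval i).locallyLipschitz
  have h_term (i j : Fin n) :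
      LocallyLipschitz fun X : Fin n → Mat3 => a i j • φ ((X i)ᵀ * X j) := by
    have h_rel := locallyLipschitz_transpose_mul.comp ((h_eval i).prodMk (h_eval j))
    have h_smul := (lipschitzWith_smul (a i j)).locallyLipschitz.comp (hφ.comp h_rel)
    exact h_smul
  refine locallyLipschitz_pi fun i => ?_
  have h_mul_hat := locallyLipschitz_mul_hat.comp
    ((h_eval i).prodMk (locallyLipschitz_sum (N i) fun j _ => h_term i j))
  exact h_mul_hat

section RotationCurves

lemma isCompact_specialOrthogonalGroup {m : Type*} [Fintype m] [DecidableEq m] :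
    IsCompact (Matrix.specialOrthogonalGroup m ℝ : Set (Matrix m m ℝ)) := by
  have : ProperSpace (Matrix m m ℝ) := FiniteDimensional.proper ℝ _
  have h_eq : (Matrix.specialOrthogonalGroup m ℝ : Set (Matrix m m ℝ)) =
      {M | Mᵀ * M = 1} ∩ {M | M.det = 1} :=
    Set.ext fun _ => mem_specialOrthogonalGroup_iff_transpose_mul_self
  refine Metric.isCompact_of_isClosed_isBounded ?_ ?_
  · rw [h_eq]
    exact (isClosed_eq (by fun_prop) continuous_const).inter
      (isClosed_eq (by fun_prop) continuous_const)
  · refine (Metric.isBounded_closedBall (x := 0) (r := √(Fintype.card m))).subset fun M hM => ?_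
    rw [h_eq] at hM
    rw [mem_closedBall_zero_iff]
    refine Real.le_sqrt_of_sq_le ?_
    rw [frobenius_norm_sq, hM.1, Matrix.trace_one]

lemma isCompact_rotAngle_le (ρ : ℝ) :
    IsCompact {M : Mat3 | M ∈ Matrix.specialOrthogonalGroup (Fin 3) ℝ ∧ rotAngle M ≤ ρ} := by
  have h_cont : Continuous rotAngle := by
    unfold rotAngle
    fun_prop
  exact isCompact_specialOrthogonalGroup.inter_right (isClosed_le h_cont continuous_const)

lemma IsLocalRepresentation.exists_locallyLipschitz_extension {r : ℝ} {g : ℝ → ℝ}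
    (hg : IsLocalRepresentation r g) {ρ : ℝ} (hρ : ρ < r) :
    ∃ φ : Mat3 → E3, LocallyLipschitz φ ∧ ∀ P Q : SO3, rotDist P Q ≤ ρ →
      localRep g ((P : Mat3)ᵀ * Q) = φ ((P : Mat3)ᵀ * Q) := by
  have h_sub : {M : Mat3 | M ∈ Matrix.specialOrthogonalGroup (Fin 3) ℝ ∧ rotAngle M ≤ ρ} ⊆
      openRotBall r := by
    rintro M ⟨hM, h_le⟩
    refine ⟨⟨M, hM⟩, rfl, ?_⟩
    simpa [rotDist] using h_le.trans_lt hρ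
  obtain ⟨K, hK⟩ := (hg.diffeo.1.locallyLipschitzOn.mono
    h_sub).exists_lipschitzOnWith_of_compact (isCompact_rotAngle_le ρ)
  obtain ⟨φ, hφ, h_eq⟩ := hK.extend_finite_dimension
  exact ⟨φ, hφ.locallyLipschitz, fun P Q h => h_eq ⟨(P⁻¹ * Q).2, h⟩⟩

lemma mem_specialOrthogonalGroup_of_hasDerivWithinAt {X : ℝ → Mat3} {p : ℝ → E3} {b c t : ℝ}
    (hX : ContinuousOn X (Icc b c))
    (hX' : ∀ t ∈ Ico b c, HasDerivWithinAt X (X t * hat (p t)) (Ici t) t)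
    (hb : X b ∈ Matrix.specialOrthogonalGroup (Fin 3) ℝ) (ht : t ∈ Icc b c) :
    X t ∈ Matrix.specialOrthogonalGroup (Fin 3) ℝ := by
  rw [mem_specialOrthogonalGroup_iff_transpose_mul_self] at hb ⊢
  have h_orth : ∀ t ∈ Icc b c, (X t)ᵀ * X t = 1 := fun t ht =>
    transpose_mul_self_eq_one_of_skew_velocity hX hX' (fun t _ => transpose_hat (p t)) hb.1 ht
  exact ⟨h_orth t ht, det_eq_one_of_transpose_mul_self_eq_one hX h_orth hb.2 ht⟩

variable {n : ℕ} {b c : ℝ}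

lemma continuousOn_rotations_iff {R : ℝ → Fin n → SO3} {s : Set ℝ} :
    ContinuousOn R s ↔ ContinuousOn (fun t i => (R t i : Mat3)) s := by
  simp_rw [continuousOn_pi]
  exact forall_congr' fun i => Topology.IsInducing.subtypeVal.continuousOn_iff

lemma isCompact_rotations :
    IsCompact (Set.pi univ fun _ : Fin n => (Matrix.specialOrthogonalGroup (Fin 3) ℝ : Set Mat3)) :=
  isCompact_univ_pi fun _ => isCompact_specialOrthogonalGroup

lemma exists_rotations_eq_of_hasDerivWithinAt {X : ℝ → Fin n → Mat3} {p : ℝ → Fin n → E3}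
    (hX : ContinuousOn X (Icc b c))
    (hX' : ∀ t ∈ Ico b c, ∀ i, HasDerivWithinAt (fun s => X s i) (X t i * hat (p t i)) (Ici t) t)
    (hb : ∀ i, X b i ∈ Matrix.specialOrthogonalGroup (Fin 3) ℝ) :
    ∃ R : ℝ → Fin n → SO3, ∀ t ∈ Icc b c, (fun i => (R t i : Mat3)) = X t := by
  have h_mem : ∀ t, ∃ Rt : Fin n → SO3, t ∈ Icc b c → (fun i => (Rt i : Mat3)) = X t := by
    intro t
    by_cases ht : t ∈ Icc b c
    · exact ⟨fun i => ⟨X t i, mem_specialOrthogonalGroup_of_hasDerivWithinAt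
        (continuousOn_pi.1 hX i) (fun t ht => hX' t ht i) (hb i) ht⟩, fun _ => rfl⟩
    · exact ⟨1, fun h => absurd h ht⟩
  choose R hR using h_mem
  exact ⟨R, hR⟩

lemma exists_uniform_rotations_hasDerivWithinAt (a : Fin n → Fin n → ℝ) {φ : Mat3 → E3}
    (hφ : LocallyLipschitz φ) :
    ∃ ε > 0, ∀ (M : Fin n → Finset (Fin n)) (R₀ : Fin n → SO3) (b : ℝ), ∃ R : ℝ → Fin n → SO3,
      R b = R₀ ∧ ContinuousOn R (Icc b (b + ε)) ∧ ∀ t ∈ Ico b (b + ε), ∀ i,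
        HasDerivWithinAt (fun s => (R s i : Mat3))
          (closedLoopField a φ M (fun j => (R t j : Mat3)) i) (Ici t) t := by
  obtain ⟨ε, hε, h_curve⟩ := exists_uniform_hasDerivWithinAt_Ici
    (locallyLipschitz_closedLoopField a hφ) isCompact_rotations.isBounded
  refine ⟨ε, hε, fun M R₀ b => ?_⟩
  obtain ⟨γ, h₀, hγ, hγ'⟩ := h_curve M (fun i => (R₀ i : Mat3)) (fun i _ => (R₀ i).2) b
  have hγ'_i : ∀ t ∈ Ico b (b + ε), ∀ i,
      HasDerivWithinAt (fun s => γ s i) (closedLoopField a φ M (γ t) i) (Ici t) t :=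
    fun t ht => hasDerivWithinAt_pi.1 (hγ' t ht)
  obtain ⟨R, hR⟩ := exists_rotations_eq_of_hasDerivWithinAt hγ hγ'_i
    (fun i => by rw [h₀]; exact (R₀ i).2)
  refine ⟨R, ?_, continuousOn_rotations_iff.2 (hγ.congr hR), fun t ht i => ?_⟩
  · funext i
    exact Subtype.ext (congrFun ((hR b (left_mem_Icc.2 (by linarith))).trans h₀) i)
  · rw [hR t (Ico_subset_Icc_self ht)]
    refine (hγ'_i t ht i).congr_of_eventuallyEq ?_
      (congrFun (hR t (Ico_subset_Icc_self ht)) i)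
    filter_upwards [Icc_mem_nhdsGE ht.2] with s hs
    exact congrFun (hR s ⟨ht.1.trans hs.1, hs.2⟩) i

end RotationCurves

section WellPosedness

variable {n : ℕ} {r q b c s t : ℝ} {g : ℝ → ℝ} {a : Fin n → Fin n → ℝ}
  {N N' : ℝ → Fin n → Finset (Fin n)} {D : Set (Fin n → SO3)} {R R' : ℝ → Fin n → SO3}

lemma closedLoopField_eq_of_mem_closedRotBallPow (hqπ : q < Real.pi / 2) {φ : Mat3 → E3}
    (hφ : ∀ P Q : SO3, rotDist P Q ≤ 2 * q → localRep g ((P : Mat3)ᵀ * Q) = φ ((P : Mat3)ᵀ * Q))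
    (M : Fin n → Finset (Fin n)) {R : Fin n → SO3} (hR : R ∈ closedRotBallPow n q) (i : Fin n) :
    closedLoopField a φ M (fun j => (R j : Mat3)) i = R i * hat (controlLaw a g M R i) := by
  simp only [closedLoopField, controlLaw,
    fun j => hφ _ _ (rotDist_le_two_mul_of_rotDist_one_le hqπ (hR i) (hR j))]

namespace IsSolutionWithin

lemma mono (hR : IsSolutionWithin a g N D b c R) (hs : s ≤ c) : IsSolutionWithin a g N D b s R where
  continuousOn := hR.continuousOn.mono (Icc_subset_Icc_right hs)
  hasDerivWithinAt t ht := hR.hasDerivWithinAt t (Ico_subset_Ico_right hs ht)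
  mem t ht := hR.mem t (Icc_subset_Icc_right hs ht)

lemma congr (hR : IsSolutionWithin a g N D b c R) (h : EqOn R' R (Icc b c)) :
    IsSolutionWithin a g N D b c R' where
  continuousOn := hR.continuousOn.congr h
  hasDerivWithinAt t ht i := by
    rw [h (Ico_subset_Icc_self ht)]
    refine (hR.hasDerivWithinAt t ht i).congr_of_eventuallyEq ?_
      (by rw [h (Ico_subset_Icc_self ht)])
    filter_upwards [Icc_mem_nhdsGE ht.2] with u hu
    rw [h ⟨ht.1.trans hu.1, hu.2⟩]
  mem t ht := by
    rw [h ht]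
    exact hR.mem t ht

lemma congr_signal (hR : IsSolutionWithin a g N D b c R) (h : EqOn N' N (Ico b c)) :
    IsSolutionWithin a g N' D b c R where
  continuousOn := hR.continuousOn
  hasDerivWithinAt t ht := by
    rw [h ht]
    exact hR.hasDerivWithinAt t ht
  mem := hR.mem

lemma union (hbs : b ≤ s) (hsc : s ≤ c) (h₁ : IsSolutionWithin a g N D b s R)
    (h₂ : IsSolutionWithin a g N D s c R) : IsSolutionWithin a g N D b c R where
  continuousOn := by
    rw [← Icc_union_Icc_eq_Icc hbs hsc]
    exact h₁.continuousOn.union_of_isClosed h₂.continuousOn isClosed_Icc isClosed_Icc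
  hasDerivWithinAt t ht := (lt_or_ge t s).elim (fun h => h₁.hasDerivWithinAt t ⟨ht.1, h⟩)
    fun h => h₂.hasDerivWithinAt t ⟨h, ht.2⟩
  mem t ht := (le_total t s).elim (fun h => h₁.mem t ⟨ht.1, h⟩) fun h => h₂.mem t ⟨h, ht.2⟩

lemma exists_concat (hbs : b ≤ s) (hsc : s ≤ c) (hR : IsSolutionWithin a g N D b s R)
    (hR' : IsSolutionWithin a g N D s c R') (h_eq : R' s = R s) :
    ∃ S : ℝ → Fin n → SO3, S b = R b ∧ IsSolutionWithin a g N D b c S := by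
  classical
  have h_left : EqOn ((Iic s).piecewise R R') R (Icc b s) := fun t ht =>
    piecewise_eq_of_mem _ _ _ ht.2
  have h_right : EqOn ((Iic s).piecewise R R') R' (Icc s c) := fun t ht => by
    rcases ht.1.eq_or_lt with rfl | h
    · rw [piecewise_eq_of_mem _ _ _ self_mem_Iic, h_eq]
    · exact piecewise_eq_of_notMem _ _ _ (notMem_Iic.2 h)
  exact ⟨_, h_left (left_mem_Icc.2 hbs), (hR.congr h_left).union hbs hsc (hR'.congr h_right)⟩

lemma eqOn (hg : IsLocalRepresentation r g) (hqr : 2 * q < r)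
    (hR : IsSolutionWithin a g N (closedRotBallPow n q) b c R)
    (hR' : IsSolutionWithin a g N (closedRotBallPow n q) b c R') (hb : R b = R' b) :
    EqOn R R' (Icc b c) := by
  have hqπ : q < Real.pi / 2 := by linarith [hg.r_le_pi]
  obtain ⟨φ, hφ, h_ext⟩ := hg.exists_locallyLipschitz_extension hqr
  obtain ⟨K, hK⟩ := exists_common_lipschitzOnWith (locallyLipschitz_closedLoopField a hφ)
    isCompact_rotations
  have h_deriv {S : ℝ → Fin n → SO3} (hS : IsSolutionWithin a g N (closedRotBallPow n q) b c S) :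
      ∀ t ∈ Ico b c, HasDerivWithinAt (fun s j => (S s j : Mat3))
        (closedLoopField a φ (N t) (fun j => (S t j : Mat3))) (Ici t) t := by
    refine fun t ht => hasDerivWithinAt_pi.2 fun i => ?_
    rw [closedLoopField_eq_of_mem_closedRotBallPow hqπ h_ext (N t)
      (hS.mem t (Ico_subset_Icc_self ht))]
    exact hS.hasDerivWithinAt t ht i
  have h_eq := ODE_solution_unique_of_mem_Icc_right (v := fun t => closedLoopField a φ (N t))
    (s := fun _ => Set.pi univ fun _ => Matrix.specialOrthogonalGroup (Fin 3) ℝ)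
    (fun t _ => hK (N t)) (continuousOn_rotations_iff.1 hR.continuousOn) (h_deriv hR)
    (fun t _ i _ => (R t i).2) (continuousOn_rotations_iff.1 hR'.continuousOn) (h_deriv hR')
    (fun t _ i _ => (R' t i).2) (by rw [hb])
  exact fun t ht => funext fun i => Subtype.ext (congrFun (h_eq ht) i)

end IsSolutionWithin

lemma exists_uniform_isSolutionWithin (hg : IsLocalRepresentation r g) (ha : ∀ i j, 0 ≤ a i j)
    (hqr : 2 * q < r) :
    ∃ ε > 0, ∀ (M : Fin n → Finset (Fin n)), ∀ R₀ ∈ closedRotBallPow n q, ∀ b : ℝ,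
      ∃ R : ℝ → Fin n → SO3, R b = R₀ ∧
        IsSolutionWithin a g (fun _ => M) (closedRotBallPow n q) b (b + ε) R := by
  obtain ⟨q', hqq', hq'r⟩ : ∃ q', q < q' ∧ q' < r / 2 := exists_between (by linarith)
  have hq'π : q' < Real.pi / 2 := by linarith [hg.r_le_pi]
  obtain ⟨φ, hφ, h_ext⟩ := hg.exists_locallyLipschitz_extension (show 2 * q' < r by linarith)
  obtain ⟨ε, hε, h_curve⟩ := exists_uniform_rotations_hasDerivWithinAt a hφ
  refine ⟨ε, hε, fun M R₀ hR₀ b => ?_⟩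
  obtain ⟨R, rfl, hR, hR'⟩ := h_curve M R₀ b
  have h_deriv : ∀ t ∈ Ico b (b + ε), R t ∈ closedRotBallPow n q' → ∀ i,
      HasDerivWithinAt (fun s => (R s i : Mat3)) (R t i * hat (controlLaw a g M (R t) i))
        (Ici t) t := fun t ht hRt i => by
    rw [← closedLoopField_eq_of_mem_closedRotBallPow hq'π h_ext M hRt]
    exact hR' t ht i
  have h_mem : ∀ t ∈ Icc b (b + ε), R t ∈ closedRotBallPow n q := fun t ht =>
    mem_closedRotBallPow_of_hasDerivWithinAt (N := fun _ => M) hg.nonneg ha hqq' hq'π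
      (by linarith) hR hR₀ h_deriv ht
  exact ⟨R, rfl, hR, fun t ht => h_deriv t ht fun i =>
    (h_mem t (Ico_subset_Icc_self ht) i).trans hqq'.le, h_mem⟩

lemma IsWellBehaved.exists_eventually_eq_nhdsLT {α : Type*} {s : ℝ → α} (hs : IsWellBehaved s)
    (t : ℝ) : ∃ x, ∀ᶠ u in 𝓝[<] t, s u = x := by
  have h_closed : IsClosed ((switchTimes s ∩ Icc (t - 1) t) \ {t}) :=
    (hs.locally_finite (t - 1) t).sdiff.isClosed
  have h_no_switch : ∀ᶠ u in 𝓝[<] t, u ∉ switchTimes s := by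
    filter_upwards [nhdsWithin_le_nhds (h_closed.isOpen_compl.mem_nhds fun h => h.2 rfl),
      Ico_mem_nhdsLT (sub_one_lt t)] with u hu hut h_switch
    exact hu ⟨⟨h_switch, Ico_subset_Icc_self hut⟩, hut.2.ne⟩
  obtain ⟨l, hlt, hl⟩ := mem_nhdsLT_iff_exists_Ioo_subset.1 h_no_switch
  let _ : TopologicalSpace α := ⊥
  have : DiscreteTopology α := ⟨rfl⟩
  have h_cont : ContinuousOn s (Ioo l t) := fun w hw =>
    (continuousAt_const.congr ((not_not.1 (hl hw)).mono fun _ h => h.symm)).continuousWithinAt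
  obtain ⟨m, hm⟩ : (Ioo l t).Nonempty := nonempty_Ioo.2 hlt
  refine ⟨s m, ?_⟩
  filter_upwards [Ioo_mem_nhdsLT hlt] with u hu
  exact isPreconnected_Ioo.constant h_cont hu hm

lemma forall_of_forall_eventually_extends {P : ℝ → Prop} (h_anti : ∀ s t, s ≤ t → P t → P s)
    (hb : P b) (h_left : ∀ t, b < t → ∀ᶠ s in 𝓝[<] t, P s → P t)
    (h_right : ∀ t, b ≤ t → P t → ∃ᶠ s in 𝓝[>] t, P s) (c : ℝ) : P c := by
  by_contra hc
  have h_bdd : BddAbove {t | P t} :=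
    ⟨c, fun t ht => le_of_not_ge fun hct => hc (h_anti c t hct ht)⟩
  set τ := sSup {t | P t}
  have hbτ : b ≤ τ := le_csSup h_bdd hb
  have h_lt : ∀ s < τ, P s := fun s hs => by
    obtain ⟨t, ht, hst⟩ := exists_lt_of_lt_csSup ⟨b, hb⟩ hs
    exact h_anti s t hst.le ht
  have hτ : P τ := by
    rcases hbτ.eq_or_lt with h | h
    · rwa [← h]
    · obtain ⟨s, h_ext, hs⟩ := ((h_left τ h).and self_mem_nhdsWithin).exists
      exact h_ext (h_lt s hs)
  obtain ⟨s, hs, hτs⟩ := ((h_right τ hbτ hτ).and_eventually self_mem_nhdsWithin).exists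
  exact (le_csSup h_bdd hs).not_gt hτs

lemma exists_isSolutionWithin (hg : IsLocalRepresentation r g) (ha : ∀ i j, 0 ≤ a i j)
    (hqr : 2 * q < r) (hN : IsWellBehaved N) {R₀ : Fin n → SO3}
    (hR₀ : R₀ ∈ closedRotBallPow n q) (b c : ℝ) :
    ∃ R : ℝ → Fin n → SO3, R b = R₀ ∧ IsSolutionWithin a g N (closedRotBallPow n q) b c R := by
  obtain ⟨ε, hε, h_local⟩ := exists_uniform_isSolutionWithin hg ha hqr
  have h_extend {s t : ℝ} {M : Fin n → Finset (Fin n)} (hbs : b ≤ s) (hst : s ≤ t)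
      (htε : t ≤ s + ε) (hM : ∀ u ∈ Ico s t, N u = M) :
      (∃ R, R b = R₀ ∧ IsSolutionWithin a g N (closedRotBallPow n q) b s R) →
        ∃ R, R b = R₀ ∧ IsSolutionWithin a g N (closedRotBallPow n q) b t R := by
    rintro ⟨R, rfl, hR⟩
    obtain ⟨S, hS₀, hS⟩ := h_local M (R s) (hR.mem s (right_mem_Icc.2 hbs)) s
    exact hR.exists_concat hbs hst ((hS.mono htε).congr_signal hM) hS₀
  refine forall_of_forall_eventually_extends (b := b)
    (P := fun c => ∃ R, R b = R₀ ∧ IsSolutionWithin a g N (closedRotBallPow n q) b c R)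
    ?_ ?_ (fun t hbt => ?_) (fun t hbt ht => ?_) c
  · rintro s t hst ⟨R, h₀, hR⟩
    exact ⟨R, h₀, hR.mono hst⟩
  · obtain ⟨R, h₀, hR⟩ := h_local (N b) R₀ hR₀ b
    exact ⟨R, h₀, (hR.mono (by linarith)).congr_signal (by simp)⟩
  · obtain ⟨M, hM⟩ := hN.exists_eventually_eq_nhdsLT t
    obtain ⟨l, hlt, hl⟩ := mem_nhdsLT_iff_exists_Ioo_subset.1 hM
    filter_upwards [Ioo_mem_nhdsLT (show max l (max b (t - ε)) < t by
      simpa [hbt] using ⟨hlt, hε⟩)] with s hs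
    simp only [mem_Ioo, max_lt_iff] at hs
    exact h_extend hs.1.2.1.le hs.2.le (by linarith [hs.1.2.2])
      fun u hu => hl ⟨hs.1.1.trans_le hu.1, hu.2⟩
  · obtain ⟨l, htl, hl⟩ := mem_nhdsGT_iff_exists_Ioo_subset.1 (hN.right_cont t)
    refine Filter.Eventually.frequently ?_
    filter_upwards [Ioo_mem_nhdsGT (show t < min l (t + ε) by simpa [hε] using htl)] with s hs
    simp only [mem_Ioo, lt_min_iff] at hs
    refine h_extend hbt hs.1.le hs.2.2.le (M := N t) (fun u hu => ?_) ht
    rcases hu.1.eq_or_lt with rfl | htu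
    · rfl
    · exact hl ⟨htu, hu.2.trans hs.2.1⟩

lemma exists_forall_isSolutionWithin (hg : IsLocalRepresentation r g) (ha : ∀ i j, 0 ≤ a i j)
    (hqr : 2 * q < r) (hN : IsWellBehaved N) {R₀ : Fin n → SO3}
    (hR₀ : R₀ ∈ closedRotBallPow n q) (b : ℝ) :
    ∃ R : ℝ → Fin n → SO3, R b = R₀ ∧
      ∀ c, IsSolutionWithin a g N (closedRotBallPow n q) b c R := by
  choose S hS₀ hS using exists_isSolutionWithin hg ha hqr hN hR₀ b
  refine ⟨fun t => S t t, hS₀ b, fun c => (hS c).congr fun t ht => ?_⟩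
  exact (hS t).eqOn hg hqr ((hS c).mono ht.2) ((hS₀ t).trans (hS₀ c).symm)
    (right_mem_Icc.2 ht.1)

lemma isSolutionOn_Ici (hR : ∀ c, IsSolutionWithin a g N D b c R) :
    IsSolutionOn a g N (Ici b) R := by
  refine ⟨fun t ht => ?_, fun t ht => (hR (t + 1)).hasDerivWithinAt t ⟨ht, lt_add_one t⟩⟩
  refine ((hR (t + 1)).continuousOn t ⟨ht, (lt_add_one t).le⟩).mono_of_mem_nhdsWithin ?_
  exact inter_mem_nhdsWithin (Ici b) (Iic_mem_nhds (lt_add_one t))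

lemma IsSolutionOn.isSolutionWithin (hg : IsLocalRepresentation r g) (ha : ∀ i j, 0 ≤ a i j)
    (hqr : 2 * q < r) {J : Set ℝ} (hR : IsSolutionOn a g N J R) (hJ : Icc b c ⊆ J)
    (hb : R b ∈ closedRotBallPow n q) :
    IsSolutionWithin a g N (closedRotBallPow n q) b c R := by
  obtain ⟨q', hqq', hq'r⟩ : ∃ q', q < q' ∧ q' < r / 2 := exists_between (by linarith)
  have h_deriv := fun t (ht : t ∈ Ico b c) => hR.2 t (hJ (Ico_subset_Icc_self ht))
  exact ⟨hR.1.mono hJ, h_deriv, fun t ht => mem_closedRotBallPow_of_hasDerivWithinAt hg.nonneg ha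
    hqq' (by linarith [hg.r_le_pi]) (by linarith) (hR.1.mono hJ) hb (fun t ht _ => h_deriv t ht) ht⟩

theorem stronglyForwardInvariant_closedRotBallPow (hg : IsLocalRepresentation r g)
    (ha : ∀ i j, 0 ≤ a i j) (hqr : 2 * q < r) :
    StronglyForwardInvariant a g (closedRotBallPow n q) := by
  intro N hN _ t₀ R₀ hR₀
  obtain ⟨R, h₀, hR⟩ := exists_forall_isSolutionWithin hg ha hqr hN hR₀ t₀
  refine ⟨R, isSolutionOn_Ici hR, h₀, fun t ht => (hR t).mem t ⟨ht, le_rfl⟩,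
    fun T R' hR' h₀' t ht => ?_⟩
  have hR'_within := hR'.isSolutionWithin hg ha hqr (Icc_subset_Ico_right ht.2) (by rwa [h₀'])
  exact hR'_within.eqOn hg hqr (hR t) (h₀'.trans h₀.symm) (right_mem_Icc.2 ht.1)

end WellPosedness

section Stability

variable {n : ℕ} {r q k d : ℝ} {g : ℝ → ℝ} {a : Fin n → Fin n → ℝ}

lemma configDist_nonneg (R S : Fin n → SO3) : 0 ≤ configDist R S := Real.sqrt_nonneg _

lemma configDistToSet_nonneg (R : Fin n → SO3) (D : Set (Fin n → SO3)) :
    0 ≤ configDistToSet R D :=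
  Real.sInf_nonneg (forall_mem_image.2 fun S _ => configDist_nonneg R S)

lemma configDistToSet_le (R : Fin n → SO3) {D : Set (Fin n → SO3)} {S : Fin n → SO3}
    (hS : S ∈ D) : configDistToSet R D ≤ configDist R S :=
  csInf_le ⟨0, forall_mem_image.2 fun S _ => configDist_nonneg R S⟩ (mem_image_of_mem _ hS)

lemma rotDist_sq_le_configDist_sq (R S : Fin n → SO3) (i : Fin n) :
    rotDist (R i) (S i) ^ 2 ≤ configDist R S ^ 2 := by
  rw [configDist, Real.sq_sqrt (by positivity)]
  exact Finset.single_le_sum (f := fun i => rotDist (R i) (S i) ^ 2)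
    (fun i _ => sq_nonneg _) (Finset.mem_univ i)

lemma const_mem_synchronizedSet {R : Fin n → SO3} (hR : R ∈ closedRotBallPow n q) (i : Fin n) :
    (fun _ => R i) ∈ synchronizedSet n q :=
  ⟨fun _ => hR i, fun _ _ => rfl⟩

lemma chordSq_le_configDistToSet_sq {R : Fin n → SO3} (hR : R ∈ closedRotBallPow n q)
    (i j : Fin n) :
    chordSq (R i) (R j) ≤ 4 * configDistToSet R (synchronizedSet n q) ^ 2 := by
  suffices h : √(chordSq (R i) (R j)) / 2 ≤ configDistToSet R (synchronizedSet n q) by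
    have h_sq := pow_le_pow_left₀ (by positivity) h 2
    rw [div_pow, Real.sq_sqrt (chordSq_nonneg _ _)] at h_sq
    linarith
  refine le_csInf ⟨_, mem_image_of_mem _ (const_mem_synchronizedSet hR i)⟩
    (forall_mem_image.2 fun S hS => ?_)
  have h_agent : ∀ l, chordSq (R l) (S l) ≤ configDist R S ^ 2 := fun l =>
    (chordSq_le_rotDist_sq (R l) (S l)).trans (rotDist_sq_le_configDist_sq R S l)
  rw [div_le_iff₀ two_pos]
  refine Real.sqrt_le_iff.2 ⟨by linarith [configDist_nonneg R S], ?_⟩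
  calc chordSq (R i) (R j) ≤ 2 * chordSq (R i) (S i) + 2 * chordSq (S i) (R j) :=
        chordSq_le_two_mul_add _ _ _
    _ = 2 * chordSq (R i) (S i) + 2 * chordSq (R j) (S j) := by
        rw [hS.2 i j, chordSq_comm (S j)]
    _ ≤ (configDist R S * 2) ^ 2 := by linarith [h_agent i, h_agent j]

lemma configDistToSet_synchronizedSet_le {R : Fin n → SO3} (hR : R ∈ closedRotBallPow n q)
    (hd : 0 ≤ d) (h : ∀ i j, chordSq (R i) (R j) ≤ 4 * d ^ 2) :
    configDistToSet R (synchronizedSet n q) ≤ Real.pi * √n * d := by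
  rcases isEmpty_or_nonempty (Fin n) with hn | ⟨⟨i₀⟩⟩
  · have h_mem : R ∈ synchronizedSet n q := ⟨hR, fun i => hn.elim i⟩
    refine (configDistToSet_le R h_mem).trans ?_
    rw [configDist, Finset.univ_eq_empty, Finset.sum_empty, Real.sqrt_zero]
    positivity
  · refine (configDistToSet_le R (const_mem_synchronizedSet hR i₀)).trans ?_
    refine Real.sqrt_le_iff.2 ⟨by positivity, ?_⟩
    calc ∑ i, rotDist (R i) (R i₀) ^ 2 ≤ ∑ _i : Fin n, Real.pi ^ 2 / 4 * (4 * d ^ 2) :=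
          Finset.sum_le_sum fun i _ => (rotDist_sq_le _ _).trans (by gcongr; exact h i i₀)
      _ = n * (Real.pi ^ 2 * d ^ 2) := by
          rw [Finset.sum_const, Finset.card_fin, nsmul_eq_mul]
          ring
      _ = (Real.pi * √n * d) ^ 2 := by
          rw [mul_pow, mul_pow, Real.sq_sqrt (Nat.cast_nonneg n)]
          ring

lemma exists_pos_forall_le {ι : Type*} [Finite ι] {w : ι → ℝ} (hw : ∀ i, 0 < w i) :
    ∃ α > 0, ∀ i, α ≤ w i := by
  rcases isEmpty_or_nonempty ι with h | h
  · exact ⟨1, one_pos, fun i => h.elim i⟩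
  · obtain ⟨i, hi⟩ := Finite.exists_min w
    exact ⟨w i, hw i, hi⟩

theorem globallyExponentiallyStableRel_synchronizedSet (hg : IsLocalRepresentation r g)
    (hk : 0 < k) (hgk : ∀ θ ∈ Ico 0 r, k * θ ≤ g θ) (ha : ∀ i j, 0 < a i j) (hqr : 2 * q < r)
    {N : ℝ → Fin n → Finset (Fin n)} (h_edge : ∀ t i j, j ∈ N t i ∨ i ∈ N t j) :
    GloballyExponentiallyStableRel a g N (synchronizedSet n q) (closedRotBallPow n q) := by
  have hr := hg.r_pos
  have hrπ := hg.r_le_pi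
  obtain ⟨p, hqp, hp0, hpr⟩ : ∃ p, q ≤ p ∧ 0 ≤ p ∧ p < r / 2 :=
    ⟨max q 0, le_max_left q 0, le_max_right q 0, max_lt (by linarith) (by linarith)⟩
  have hcos := Real.cos_pos_of_mem_Ioo (x := p) ⟨by linarith, by linarith⟩
  obtain ⟨α, hα, h_weights⟩ := exists_pos_forall_le fun e : Fin n × Fin n => ha e.1 e.2
  set lam := α * k * Real.cos p ^ 2 with h_lam
  refine ⟨Real.pi * √n + 1, by positivity, lam, by positivity, fun t₀ R hR h₀ t ht => ?_⟩
  set d₀ := configDistToSet (R t₀) (synchronizedSet n q)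
  have hd₀ : 0 ≤ d₀ := configDistToSet_nonneg _ _
  have h_within {q' : ℝ} (hq' : q' < r / 2) (h : R t₀ ∈ closedRotBallPow n q') :
      IsSolutionWithin a g N (closedRotBallPow n q') t₀ t R :=
    hR.isSolutionWithin hg (fun i j => (ha i j).le) (by linarith) Icc_subset_Ici_self h
  have h_init : ∀ i j, chordSq (R t₀ i) (R t₀ j) ≤ 4 * d₀ ^ 2 := chordSq_le_configDistToSet_sq h₀
  have h_decay : ∀ i j, chordSq (R t i) (R t j) ≤ 4 * (d₀ * Real.exp (-lam * (t - t₀))) ^ 2 := by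
    intro i j
    refine (chordSq_le_mul_exp_of_isSolutionWithin hk.le hgk hα.le (fun i j => h_weights (i, j))
      (by linarith) (by linarith) h_edge (h_within hpr fun i => (h₀ i).trans hqp)
      h_init (right_mem_Icc.2 ht) i j).trans_eq ?_
    rw [mul_pow, ← Real.exp_nat_mul, h_lam]
    push_cast
    ring_nf
  calc configDistToSet (R t) (synchronizedSet n q)
      ≤ Real.pi * √n * (d₀ * Real.exp (-lam * (t - t₀))) :=
        configDistToSet_synchronizedSet_le
          ((h_within (by linarith) h₀).mem t (right_mem_Icc.2 ht)) (by positivity) h_decay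
    _ ≤ (Real.pi * √n + 1) * (d₀ * Real.exp (-lam * (t - t₀))) := by
        gcongr
        exact le_add_of_nonneg_right zero_le_one
    _ = (Real.pi * √n + 1) * Real.exp (-lam * (t - t₀)) * d₀ := by ring

end Stability

theorem mainTheorem4_general {n : ℕ} {r q k : ℝ} {g : ℝ → ℝ} {a : Fin n → Fin n → ℝ}
    {N : ℝ → Fin n → Finset (Fin n)} (hg : IsLocalRepresentation r g) (hk : 0 < k)
    (hgk : ∀ θ ∈ Ico 0 r, k * θ ≤ g θ) (ha : ∀ i j, 0 < a i j)
    (h_edge : ∀ t i j, j ∈ N t i ∨ i ∈ N t j) (hq : q < r / 2) :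
    StronglyForwardInvariant a g (closedRotBallPow n q) ∧
      GloballyExponentiallyStableRel a g N (synchronizedSet n q) (closedRotBallPow n q) := by
  have hqr : 2 * q < r := by linarith
  exact ⟨stronglyForwardInvariant_closedRotBallPow hg (fun i j => (ha i j).le) hqr,
    globallyExponentiallyStableRel_synchronizedSet hg hk hgk ha hqr h_edge⟩

theorem mainTheorem4 (n : ℕ)
    (r : ℝ) (g : ℝ → ℝ) (hg : IsLocalRepresentation r g)
    (k : ℝ) (hk : 0 < k) (hgk : ∀ θ ∈ Ico 0 r, k * θ ≤ g θ)
    (a : Fin n → Fin n → ℝ) (ha : ∀ i j, 0 < a i j)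
    (τD : ℝ) (hτD : 0 < τD)
    (N : ℝ → Fin n → Finset (Fin n))
    (hN : ∀ i, HasDwellTime τD (fun t => N t i))
    (hself : ∀ t i, i ∈ N t i)
    (hedge : ∀ t i j, j ∈ N t i ∨ i ∈ N t j)
    (q : ℝ) (hq : q < r / 2) :
    StronglyForwardInvariant a g (closedRotBallPow n q) ∧
      GloballyExponentiallyStableRel a g N (synchronizedSet n q) (closedRotBallPow n q) :=
  mainTheorem4_general hg hk hgk ha hedge hq
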